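/- Let $\mathcal P$ be the set of primes and let $\mathbb N$ be the set of strictly positive integers. For $\boldsymbol m=(m_p)_{p\in\mathcal P}\in\mathbb N^{\mathcal P}$ let $\mathbb Z[\frac1{\mathcal P^{\boldsymbol m}}]\le\mathbb Q$ be the group of all rationals $a/b$ with $a\in\mathbb Z$, $b\in\mathbb N$, such that for all $p\in\mathcal P$ and $k\in\mathbb N$, if $p^k$ divides $b$ then $k\le m_p$. Write $\boldsymbol m=^*\boldsymbol m'$ if $\{p\in\mathcal P: m_p\ne m'_p\}$ is finite. An (abelian) group with a Polish cover is a quotient $G/N$ presented by an abelian Polish group $G$ and a Polishable subgroup $N\le G$ (some Polish group topology on $N$ generates the Borel structure inherited from $G$). Two of them, $G/N$ and $G'/N'$, are isomorphic as discrete groups if $G/N\cong G'/N'$ as abstract groups, and definably (or Borel) isomorphic if there is a group isomorphism $f:G/N\to G'/N'$ with a Borel lift, that is, a Borel function $\hat f:G\to G'$ (not necessarily a homomorphism) with $f(x+N)=\hat f(x)+N'$ for all $x\in G$. For countable abelian groups $B,F$, $\mathrm{Ext}(B,F)=\mathrm Z(B,F)/\mathrm B(B,F)$ is the group with a Polish cover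 in which $\mathrm Z(B,F)\le F^{B\times B}$ ($F$ discrete, product topology) is the group of functions $c$ with $c(x,0)=c(0,x)=0$, $c(x,y)+c(x+y,z)=c(x,y+z)+c(y,z)$ and $c(x,y)=c(y,x)$, and $\mathrm B(B,F)$ is the subgroup of those $c\in\mathrm Z(B,F)$ of the form $c(x,y)=h(x)+h(y)-h(x+y)$ for some $h:B\to F$. For $\mathbb Z^d\le\Lambda\le\mathbb Q^d$, a cofiltration of $\Lambda$ is an increasing sequence $\mathbb Z^d=\Lambda_{(0)}\le\Lambda_{(1)}\le\cdots$ of finitely generated subgroups of $\mathbb Q^d$ with union $\Lambda$. Let $\Lambda^{(n)}=\{x\in\mathbb Z^d:\sum_i x_iy_i\in\mathbb Z\text{ for all }y\in\Lambda_{(n)}\}$, and let $\hat{\mathbb Z}^d_\Lambda/\mathbb Z^d$ be the group with a Polish cover given by $\hat{\mathbb Z}^d_\Lambda=\varprojlim_n\mathbb Z^d/\Lambda^{(n)}$ and the image of $\mathbb Z^d$ in it. Fix $d\ge1$. 1. For all $\boldsymbol m,\boldsymbol m'\in\mathbb N^{\mathcal P}$, the groups $\mathrm{Ext}(\mathbb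 Z[\frac1{\mathcal P^{\boldsymbol m}}]^d,\mathbb Z)$ and $\mathrm{Ext}(\mathbb Z[\frac1{\mathcal P^{\boldsymbol m'}}]^d,\mathbb Z)$ are isomorphic as discrete groups, and they are definably isomorphic if and only if $\boldsymbol m=^*\boldsymbol m'$. In particular, the collection $\{\mathrm{Ext}(\mathbb Z[\frac1{\mathcal P^{\boldsymbol m}}]^d,\mathbb Z):\boldsymbol m\in\mathbb N^{\mathcal P}\}$ contains a subset of cardinality $2^{\aleph_0}$ whose members are pairwise isomorphic as discrete groups but not definably isomorphic. 2. The same holds for the groups with a Polish cover $\hat{\mathbb Z}^d_\Lambda/\mathbb Z^d$ with $\Lambda=\mathbb Z[\frac1{\mathcal P^{\boldsymbol m}}]^d$, $\boldsymbol m\in\mathbb N^{\mathcal P}$, for any choice of cofiltrations of the groups $\Lambda$. Moreover, for every $\boldsymbol m\in\mathbb N^{\mathcal P}$ and every cofiltration of $\Lambda=\mathbb Z[\frac1{\mathcal P^{\boldsymbol m}}]^d$, as discrete groups $$\hat{\mathbb Z}^d_\Lambda/\mathbb Z^d\;\cong\;\mathbb Q^{(2^{\aleph_0})}\oplus\Big(\bigoplus_{p\in\mathcal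 P}\mathbb Z(p^\infty)\Big)^d,$$ where $\mathbb Q^{(2^{\aleph_0})}$ is the direct sum of $2^{\aleph_0}$ copies of $\mathbb Q$ and $\mathbb Z(p^\infty)=\mathbb Q_p/\mathbb Z_p$ is the Prüfer $p$-group. -/

import Mathlib

open Topology Uniformity

namespace DefinableExt

/-- A countable product of countable discrete spaces is Polish. -/
theorem polishSpace_pi {ι : Type*} [Countable ι] (X : ι → Type*) [∀ i, TopologicalSpace (X i)]
    [∀ i, DiscreteTopology (X i)] [∀ i, Countable (X i)] : PolishSpace (∀ i, X i) := by
  have : ∀ i, PolishSpace (X i) := fun i => inferInstance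
  have : SecondCountableTopology (∀ i, X i) := inferInstance
  infer_instance

/-! ### Abelian groups with a Polish cover -/

/-- A subgroup `N` of a topological group `G` is Polishable if some Polish group topology on `N`
generates the Borel structure that `N` inherits from `G`. -/
def IsPolishable {G : Type*} [AddCommGroup G] [TopologicalSpace G] (N : AddSubgroup G) : Prop :=
  ∃ τ : TopologicalSpace N, @PolishSpace N τ ∧ @IsTopologicalAddGroup N τ _ ∧
    @borel N τ = (borel G).comap ((↑) : N → G)

/-- An abelian Polish group `G` together with a Polishable subgroup `N`; it represents the
quotient `G ⧸ N`. -/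
structure PolishCover where
  /-- the covering Polish group -/
  G : Type
  [addCommGroup : AddCommGroup G]
  [topologicalSpace : TopologicalSpace G]
  [isTopologicalAddGroup : IsTopologicalAddGroup G]
  [polishSpace : PolishSpace G]
  /-- the Polishable subgroup -/
  N : AddSubgroup G
  polishable : IsPolishable N

attribute [instance] PolishCover.addCommGroup PolishCover.topologicalSpace
  PolishCover.isTopologicalAddGroup PolishCover.polishSpace

/-- The quotient group `G ⧸ N` as a discrete (abstract) group. -/
abbrev PolishCover.Quot (X : PolishCover) : Type := X.G ⧸ X.N

/-- `X` and `Y` are isomorphic as discrete groups. -/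
def AbstractlyIsomorphic (X Y : PolishCover) : Prop := Nonempty (X.Quot ≃+ Y.Quot)

/-- `X` and `Y` are (Borel-)definably isomorphic: some isomorphism between the quotient groups
lifts to a Borel function (not necessarily a homomorphism) between the covering groups. -/
def DefinablyIsomorphic (X Y : PolishCover) : Prop :=
  ∃ (f : X.Quot ≃+ Y.Quot) (φ : X.G → Y.G), @Measurable X.G Y.G (borel X.G) (borel Y.G) φ ∧
    ∀ x : X.G, f (QuotientAddGroup.mk x) = QuotientAddGroup.mk (φ x)

/-- The image of a continuous homomorphism from a Polish group is Polishable. -/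
theorem isPolishable_range {H G : Type*} [AddCommGroup H] [UniformSpace H] [IsUniformAddGroup H]
    [CompleteSpace H] [(𝓤 H).IsCountablyGenerated] [SecondCountableTopology H]
    [AddCommGroup G] [TopologicalSpace G] [T2Space G] [SecondCountableTopology G]
    (f : H →+ G) (hf : Continuous f) : IsPolishable f.range := by
  have hcl : IsClosed (f.ker : Set H) := by
    have : (f.ker : Set H) = f ⁻¹' {0} := by ext x; simp [AddMonoidHom.mem_ker]
    rw [this]
    exact isClosed_singleton.preimage hf
  let : UniformSpace (H ⧸ f.ker) := IsTopologicalAddGroup.rightUniformSpace (H ⧸ f.ker)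
  have : IsUniformAddGroup (H ⧸ f.ker) := isUniformAddGroup_of_addCommGroup
  have : CompleteSpace (H ⧸ f.ker) := QuotientAddGroup.completeSpace_right H f.ker
  have : SecondCountableTopology (H ⧸ f.ker) :=
    QuotientAddGroup.isOpenQuotientMap_mk.isQuotientMap.secondCountableTopology
      QuotientAddGroup.isOpenQuotientMap_mk.isOpenMap
  have : IsClosed (f.ker : Set H) := hcl
  have : T2Space (H ⧸ f.ker) := inferInstance
  have : (𝓤 (H ⧸ f.ker)).IsCountablyGenerated :=
    IsUniformAddGroup.uniformity_countably_generated
  have : PolishSpace (H ⧸ f.ker) := inferInstance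
  let e : f.range ≃+ H ⧸ f.ker := (QuotientAddGroup.quotientKerEquivRange f).symm
  let τ : TopologicalSpace f.range := TopologicalSpace.induced e inferInstance
  have hP : @PolishSpace f.range τ := e.toEquiv.polishSpace_induced
  refine ⟨τ, hP, topologicalAddGroup_induced e, ?_⟩
  have hval : @Continuous f.range G τ _ (Subtype.val) := by
    have h1 : Continuous (QuotientAddGroup.kerLift f) := by
      apply Continuous.quotient_lift
      exact hf
    have h2 : (Subtype.val : f.range → G) = QuotientAddGroup.kerLift f ∘ e := by
      funext y
      obtain ⟨x, rfl⟩ := e.symm.surjective y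
      simp only [Function.comp_apply, AddEquiv.apply_symm_apply]
      induction x using QuotientAddGroup.induction_on with
      | H z => rfl
    rw [h2]
    exact h1.comp (continuous_induced_dom)
  let : MeasurableSpace G := borel G
  have : BorelSpace G := ⟨rfl⟩
  let m : MeasurableSpace f.range := @borel _ τ
  have hB : @BorelSpace f.range τ m := @BorelSpace.mk _ τ m rfl
  have hemb : MeasurableEmbedding (Subtype.val : f.range → G) :=
    @Continuous.measurableEmbedding f.range G _ _ _ _ _ τ hP m hB hval Subtype.val_injective
  exact hemb.comap_eq.symm

/-- A countable subgroup is Polishable (by the discrete topology). -/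
theorem isPolishable_of_countable {G : Type*} [AddCommGroup G] [TopologicalSpace G] [T1Space G]
    (N : AddSubgroup G) [Countable N] : IsPolishable N := by
  let : TopologicalSpace N := ⊥
  have : DiscreteTopology N := ⟨rfl⟩
  refine ⟨⊥, inferInstance, inferInstance, ?_⟩
  let : MeasurableSpace G := borel G
  have : BorelSpace G := ⟨rfl⟩
  let m : MeasurableSpace N := (borel G).comap ((↑) : N → G)
  have : MeasurableSingletonClass N := Subtype.instMeasurableSingletonClass
  refine le_antisymm ?_ ?_
  · exact fun s _ => (Set.to_countable s).measurableSet
  · intro s _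
    exact MeasurableSpace.measurableSet_generateFrom (isOpen_discrete s)

/-! ### The definable `Ext` group -/

section Ext

variable (B F : Type) [AddCommGroup B] [AddCommGroup F]

/-- `Z(B, F)`: the (symmetric, normalized) cocycles on `B` with coefficients in `F`. -/
def cocycles : AddSubgroup (B × B → F) where
  carrier := {c | (∀ x, c (x, 0) = 0 ∧ c (0, x) = 0) ∧
    (∀ x y z, c (x, y) + c (x + y, z) = c (x, y + z) + c (y, z)) ∧
    ∀ x y, c (x, y) = c (y, x)}
  zero_mem' := by simp
  add_mem' := by
    rintro a b ⟨ha, ha', ha''⟩ ⟨hb, hb', hb''⟩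
    refine ⟨fun x => by simp [ha x, hb x], fun x y z => ?_, fun x y => ?_⟩
    · have h1 := ha' x y z
      have h2 := hb' x y z
      simp only [Pi.add_apply]
      rw [add_add_add_comm, h1, h2, add_add_add_comm]
    · simp only [Pi.add_apply]
      rw [ha'' x y, hb'' x y]
  neg_mem' := by
    rintro a ⟨ha, ha', ha''⟩
    refine ⟨fun x => by simp [ha x], fun x y z => ?_, fun x y => ?_⟩
    · have h1 := ha' x y z
      simp only [Pi.neg_apply]
      rw [← neg_add, h1, neg_add]
    · simp only [Pi.neg_apply]
      rw [ha'' x y]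

/-- `B(B, F)`: the cocycles of the form `(x, y) ↦ h x + h y - h (x + y)` with `h : B → F`. -/
def coboundaries : AddSubgroup (cocycles B F) where
  carrier := {c | ∃ h : B → F, ∀ x y, c.1 (x, y) = h x + h y - h (x + y)}
  zero_mem' := ⟨0, by simp⟩
  add_mem' := by
    rintro a b ⟨h, hh⟩ ⟨k, hk⟩
    refine ⟨h + k, fun x y => ?_⟩
    simp only [AddSubgroup.coe_add, Pi.add_apply, hh, hk]
    abel
  neg_mem' := by
    rintro a ⟨h, hh⟩
    refine ⟨-h, fun x y => ?_⟩
    simp only [NegMemClass.coe_neg, Pi.neg_apply, hh]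
    abel

theorem isClosed_cocycles [TopologicalSpace F] [DiscreteTopology F] :
    IsClosed (cocycles B F : Set (B × B → F)) := by
  have : (cocycles B F : Set (B × B → F)) = {c | (∀ x, c (x, 0) = 0 ∧ c (0, x) = 0) ∧
    (∀ x y z, c (x, y) + c (x + y, z) = c (x, y + z) + c (y, z)) ∧
    ∀ x y, c (x, y) = c (y, x)} := rfl
  rw [this]
  refine IsClosed.and ?_ (IsClosed.and ?_ ?_)
  · simp only [Set.ofPred_forall]
    exact isClosed_iInter fun x => IsClosed.and (isClosed_eq (by fun_prop) (by fun_prop))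
      (isClosed_eq (by fun_prop) (by fun_prop))
  · simp only [Set.ofPred_forall]
    exact isClosed_iInter fun x => isClosed_iInter fun y => isClosed_iInter fun z =>
      isClosed_eq (by fun_prop) (by fun_prop)
  · simp only [Set.ofPred_forall]
    exact isClosed_iInter fun x => isClosed_iInter fun y =>
      isClosed_eq (by fun_prop) (by fun_prop)

/-- The functions `h : B → F` with `h 0 = 0`. -/
def cochains₀ : AddSubgroup (B → F) := (Pi.evalAddMonoidHom (fun _ : B => F) 0).ker

/-- The coboundary homomorphism on normalized cochains. -/
def coboundary : cochains₀ B F →+ cocycles B F where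
  toFun h := ⟨fun p => h.1 p.1 + h.1 p.2 - h.1 (p.1 + p.2), by
    have h0 : h.1 0 = 0 := h.2
    refine ⟨fun x => by simp [h0], fun x y z => ?_, fun x y => ?_⟩
    · dsimp only
      rw [add_assoc x y z]
      abel
    · dsimp only
      rw [add_comm y x, add_comm (h.1 y)]⟩
  map_zero' := by ext; simp
  map_add' := by
    intro a b
    ext p
    simp only [AddSubgroup.coe_add, Pi.add_apply]
    abel

theorem range_coboundary : (coboundary B F).range = coboundaries B F := by
  ext c
  constructor
  · rintro ⟨h, rfl⟩
    exact ⟨h.1, fun x y => rfl⟩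
  · rintro ⟨h, hh⟩
    have h0 : h 0 = 0 := by
      have := hh 0 0
      rw [(c.2.1 0).1] at this
      simpa using this.symm
    refine ⟨⟨h, h0⟩, ?_⟩
    ext ⟨x, y⟩
    exact (hh x y).symm

theorem isPolishable_coboundaries [Countable B] [Countable F] [TopologicalSpace F]
    [DiscreteTopology F] : IsPolishable (coboundaries B F) := by
  rw [← range_coboundary]
  have : PolishSpace (B × B → F) := polishSpace_pi _
  have : SecondCountableTopology (cocycles B F) :=
    IsEmbedding.subtypeVal.secondCountableTopology
  let : UniformSpace F := IsTopologicalAddGroup.rightUniformSpace F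
  have : IsUniformAddGroup F := isUniformAddGroup_of_addCommGroup
  have : CompleteSpace F := IsRightUniformAddGroup.completeSpace_of_weaklyLocallyCompactSpace
  have : (𝓤 F).IsCountablyGenerated := IsUniformAddGroup.uniformity_countably_generated
  have hc : IsClosed (cochains₀ B F : Set (B → F)) := by
    have : (cochains₀ B F : Set (B → F)) = {h | h 0 = 0} := rfl
    rw [this]
    exact isClosed_eq (by fun_prop) (by fun_prop)
  have : CompleteSpace (cochains₀ B F) := hc.completeSpace_coe
  have : PolishSpace (B → F) := polishSpace_pi _
  have : SecondCountableTopology (cochains₀ B F) :=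
    IsEmbedding.subtypeVal.secondCountableTopology
  have : (𝓤 (cochains₀ B F)).IsCountablyGenerated :=
    IsUniformAddGroup.uniformity_countably_generated
  apply isPolishable_range
  have hev : ∀ b : B, Continuous fun h : cochains₀ B F => h.1 b := fun b =>
    (continuous_apply b).comp continuous_subtype_val
  exact Continuous.subtype_mk
    (continuous_pi fun p : B × B => ((hev p.1).add (hev p.2)).sub (hev (p.1 + p.2))) _

/-- `Ext(B, F) = Z(B, F) / B(B, F)` as a group with a Polish cover, for countable abelian groups
`B` and `F`; here `F` is discrete and `Z(B, F)` has the topology of pointwise convergence. -/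
def extCover [Countable B] [Countable F] [TopologicalSpace F] [DiscreteTopology F] :
    PolishCover :=
  haveI : PolishSpace (B × B → F) := polishSpace_pi _
  haveI : PolishSpace (cocycles B F) := (isClosed_cocycles B F).polishSpace
  { G := cocycles B F
    N := coboundaries B F
    polishable := isPolishable_coboundaries B F }

end Ext

/-! ### The groups `ℤ[1/𝒫ᵐ]ᵈ` -/

/-- `ℤ[1/𝒫ᵐ]`: the rationals `a / b` with `a ∈ ℤ`, `b` a positive integer, such that `p ^ k ∣ b`
implies `k ≤ m p`, for every prime `p` and every `k`. -/
def invPrimes (m : Nat.Primes → ℕ+) : AddSubgroup ℚ where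
  carrier := {q | ∃ (a : ℤ) (b : ℕ), 0 < b ∧
    (∀ (p : Nat.Primes) (k : ℕ), (p : ℕ) ^ k ∣ b → k ≤ m p) ∧ q = a / b}
  zero_mem' := by
    refine ⟨0, 1, one_pos, fun p k h => ?_, by simp⟩
    rcases Nat.eq_zero_or_pos k with rfl | hk
    · exact Nat.zero_le _
    · exact absurd (Nat.dvd_one.1 ((dvd_pow_self _ hk.ne').trans h)) p.2.one_lt.ne'
  add_mem' := by
    rintro _ _ ⟨a, b, hb, h, rfl⟩ ⟨a', b', hb', h', rfl⟩
    have hl : Nat.lcm b b' ≠ 0 := Nat.lcm_ne_zero hb.ne' hb'.ne'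
    refine ⟨a * (Nat.lcm b b' / b : ℕ) + a' * (Nat.lcm b b' / b' : ℕ), Nat.lcm b b',
      Nat.pos_of_ne_zero hl, fun p k hk => ?_, ?_⟩
    · rw [p.2.pow_dvd_iff_le_factorization hl, Nat.factorization_lcm hb.ne' hb'.ne',
        Finsupp.sup_apply, le_sup_iff] at hk
      rcases hk with hk | hk
      · exact h p k ((p.2.pow_dvd_iff_le_factorization hb.ne').2 hk)
      · exact h' p k ((p.2.pow_dvd_iff_le_factorization hb'.ne').2 hk)
    · have hb0 : (b : ℚ) ≠ 0 := by exact_mod_cast hb.ne'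
      have hb0' : (b' : ℚ) ≠ 0 := by exact_mod_cast hb'.ne'
      have hl0 : (Nat.lcm b b' : ℚ) ≠ 0 := by exact_mod_cast hl
      have e1 : ((Nat.lcm b b' / b : ℕ) : ℚ) = Nat.lcm b b' / b :=
        Nat.cast_div (Nat.dvd_lcm_left b b') hb0
      have e2 : ((Nat.lcm b b' / b' : ℕ) : ℚ) = Nat.lcm b b' / b' :=
        Nat.cast_div (Nat.dvd_lcm_right b b') hb0'
      rw [Int.cast_add, Int.cast_mul, Int.cast_mul, Int.cast_natCast, Int.cast_natCast, e1, e2]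
      field_simp
  neg_mem' := by
    rintro _ ⟨a, b, hb, h, rfl⟩
    exact ⟨-a, b, hb, h, by push_cast; ring⟩

/-- `ℤ[1/𝒫ᵐ]ᵈ`, as a subgroup of `ℚᵈ`. -/
def invPrimesPow (d : ℕ) (m : Nat.Primes → ℕ+) : AddSubgroup (Fin d → ℚ) :=
  AddSubgroup.pi Set.univ fun _ => invPrimes m

/-- `m =* m'`: the sequences differ at only finitely many primes. -/
def EqStar (m m' : Nat.Primes → ℕ+) : Prop := {p : Nat.Primes | m p ≠ m' p}.Finite

/-! ### Profinite completions of `ℤᵈ` -/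

/-- The copy of `ℤᵈ` inside `ℚᵈ`. -/
def intLattice (d : ℕ) : AddSubgroup (Fin d → ℚ) :=
  AddSubgroup.pi Set.univ fun _ => (Int.castAddHom ℚ).range

/-- A cofiltration of `Λ ≤ ℚᵈ`: an increasing sequence of finitely generated subgroups of `ℚᵈ`
that starts with `ℤᵈ` (so that all terms have rank `d`) and has union `Λ`. -/
structure Cofiltration {d : ℕ} (Λ : AddSubgroup (Fin d → ℚ)) where
  /-- the terms of the sequence -/
  term : ℕ → AddSubgroup (Fin d → ℚ)
  fg : ∀ n, (term n).FG
  mono : Monotone term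
  zero : term 0 = intLattice d
  mem_iff : ∀ x, x ∈ Λ ↔ ∃ n, x ∈ term n

theorem intLattice_fg (d : ℕ) : (intLattice d).FG := by
  have : intLattice d = ((Int.castAddHom ℚ).compLeft (Fin d)).range := by
    ext x
    simp only [intLattice, AddSubgroup.mem_pi, Set.mem_univ, forall_const, AddMonoidHom.mem_range]
    constructor
    · intro h
      choose k hk using h
      exact ⟨k, funext hk⟩
    · rintro ⟨k, rfl⟩ i
      exact ⟨k i, rfl⟩
  rw [this]
  have : AddGroup.FG (Fin d → ℤ) := Module.Finite.iff_addGroup_fg.1 inferInstance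
  exact (AddGroup.fg_iff_addSubgroup_fg _).1 (AddGroup.fg_range _)

theorem intLattice_le_invPrimesPow (d : ℕ) (m : Nat.Primes → ℕ+) :
    intLattice d ≤ invPrimesPow d m := by
  intro x hx i hi
  obtain ⟨k, hk⟩ := hx i hi
  refine ⟨k, 1, one_pos, fun p j h => ?_, by rw [← hk]; simp⟩
  rcases Nat.eq_zero_or_pos j with rfl | hj
  · exact Nat.zero_le _
  · exact absurd (Nat.dvd_one.1 ((dvd_pow_self _ hj.ne').trans h)) p.2.one_lt.ne'

/-- Cofiltrations exist: adjoin the elements of `Λ` one by one along an enumeration of `ℚᵈ`. -/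
theorem nonempty_cofiltration {d : ℕ} {Λ : AddSubgroup (Fin d → ℚ)} (h : intLattice d ≤ Λ) :
    Nonempty (Cofiltration Λ) := by
  refine ⟨{
    term := fun n => intLattice d ⊔ AddSubgroup.closure {x | x ∈ Λ ∧ Encodable.encode x < n}
    fg := fun n => ?_
    mono := fun a b hab => ?_
    zero := by simp
    mem_iff := fun x => ⟨fun hx => ?_, ?_⟩ }⟩
  · refine (intLattice_fg d).sup ((AddSubgroup.fg_iff _).2 ⟨_, rfl, ?_⟩)
    exact ((Set.finite_lt_nat n).preimage Encodable.encode_injective.injOn).subset fun x hx => hx.2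
  · have hs : {x | x ∈ Λ ∧ Encodable.encode x < a} ⊆ {x | x ∈ Λ ∧ Encodable.encode x < b} :=
      fun x hx => ⟨hx.1, hx.2.trans_le hab⟩
    exact sup_le_sup_left (AddSubgroup.closure_mono hs) _
  · exact ⟨Encodable.encode x + 1,
      AddSubgroup.mem_sup_right (AddSubgroup.subset_closure ⟨hx, Nat.lt_succ_self _⟩)⟩
  · rintro ⟨n, hn⟩
    exact (sup_le h ((AddSubgroup.closure_le _).2 fun y hy => hy.1)) hn

/-- The annihilator `{x | ⟨x, y⟩ ∈ ℤ for all y ∈ A}` of `A ≤ ℚᵈ` in `ℤᵈ`. When `A` contains `ℤᵈ`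
this is the annihilator of `A` in `ℝᵈ`. -/
def annihilator {d : ℕ} (A : AddSubgroup (Fin d → ℚ)) : AddSubgroup (Fin d → ℤ) where
  carrier := {x | ∀ y ∈ A, ∃ k : ℤ, ∑ i, (x i : ℚ) * y i = k}
  zero_mem' := fun y _ => ⟨0, by simp⟩
  add_mem' := by
    intro a b ha hb y hy
    obtain ⟨k, hk⟩ := ha y hy
    obtain ⟨l, hl⟩ := hb y hy
    exact ⟨k + l, by simp [add_mul, Finset.sum_add_distrib, hk, hl]⟩
  neg_mem' := by
    intro a ha y hy
    obtain ⟨k, hk⟩ := ha y hy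
    exact ⟨-k, by simp [hk]⟩

theorem annihilator_anti {d : ℕ} {A A' : AddSubgroup (Fin d → ℚ)} (h : A ≤ A') :
    annihilator A' ≤ annihilator A := fun _ hx y hy => hx y (h hy)

section Completion

variable {d : ℕ} {Λ : AddSubgroup (Fin d → ℚ)} (A : Cofiltration Λ)

/-- The dual filtration `Λ⁽ⁿ⁾ = (Λ₍ₙ₎)_⊥` of `ℤᵈ`. -/
def Cofiltration.dual (n : ℕ) : AddSubgroup (Fin d → ℤ) := annihilator (A.term n)

/-- The bonding map `ℤᵈ / Λ⁽ⁿ⁺¹⁾ → ℤᵈ / Λ⁽ⁿ⁾`. -/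
def Cofiltration.bond (n : ℕ) : (Fin d → ℤ) ⧸ A.dual (n + 1) →+ (Fin d → ℤ) ⧸ A.dual n :=
  QuotientAddGroup.map _ _ (AddMonoidHom.id _) (annihilator_anti (A.mono n.le_succ))

/-- The profinite completion of `ℤᵈ`: the inverse limit of the groups `ℤᵈ / Λ⁽ⁿ⁾`. -/
def Cofiltration.completion : AddSubgroup (∀ n, (Fin d → ℤ) ⧸ A.dual n) where
  carrier := {x | ∀ n, A.bond n (x (n + 1)) = x n}
  zero_mem' := fun n => by simp
  add_mem' := fun ha hb n => by simp [ha n, hb n]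
  neg_mem' := fun ha n => by simp [ha n]

/-- The canonical homomorphism from `ℤᵈ` to its profinite completion. -/
def Cofiltration.toCompletion : (Fin d → ℤ) →+ A.completion where
  toFun x := ⟨fun _ => QuotientAddGroup.mk x, fun _ => rfl⟩
  map_zero' := rfl
  map_add' _ _ := rfl

instance Cofiltration.discreteTopology_quotient (n : ℕ) :
    DiscreteTopology ((Fin d → ℤ) ⧸ A.dual n) :=
  QuotientAddGroup.discreteTopology (isOpen_discrete _)

theorem Cofiltration.isClosed_completion :
    IsClosed (A.completion : Set (∀ n, (Fin d → ℤ) ⧸ A.dual n)) := by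
  have : (A.completion : Set (∀ n, (Fin d → ℤ) ⧸ A.dual n)) =
    ⋂ n, {x | A.bond n (x (n + 1)) = x n} := by
      ext x
      simp only [Set.mem_iInter]
      rfl
  rw [this]
  exact isClosed_iInter fun n => isClosed_eq
    (continuous_of_discreteTopology.comp (continuous_apply (n + 1))) (continuous_apply n)

/-- The profinite completion of `ℤᵈ` (the inverse limit of the discrete groups `ℤᵈ / Λ⁽ⁿ⁾`)
modulo the canonical copy of `ℤᵈ`, as a group with a Polish cover. -/
def Cofiltration.completionCover : PolishCover :=
  haveI : ∀ n, Countable ((Fin d → ℤ) ⧸ A.dual n) := fun _ =>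
    Function.Surjective.countable QuotientAddGroup.mk_surjective
  haveI : PolishSpace (∀ n, (Fin d → ℤ) ⧸ A.dual n) := polishSpace_pi _
  haveI : PolishSpace A.completion := A.isClosed_completion.polishSpace
  haveI : Countable A.toCompletion.range :=
    (Set.countable_range A.toCompletion).to_subtype
  { G := A.completion
    N := A.toCompletion.range
    polishable := isPolishable_of_countable _ }

end Completion

/-- The Prüfer group `ℤ(p^∞) = ℚ_p / ℤ_p`. -/
abbrev Prufer (p : Nat.Primes) : Type :=
  haveI : Fact (p : ℕ).Prime := ⟨p.2⟩
  ℚ_[(p : ℕ)] ⧸ (PadicInt.subring (p : ℕ)).toAddSubgroup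

end DefinableExt

open DefinableExt

open Topology Uniformity

namespace DefinableExt

/-! ### Definable isomorphisms with definable inverse -/

/-! Every group in the theorem is compared with one model: the profinite group `∏ₚ (ℤ/p^{m_p})ᵈ`
modulo the diagonal copy of `ℤᵈ` (`modelCover`). For a completion this is the Chinese remainder
theorem: the dual of any cofiltration is cofinal with the congruence subgroups modulo finitely many
`p^{m_p}`. For `Ext`, a cocycle has a rational primitive `h` because `ℚ` is injective. With `g =
eᵢ/p^{m_p}`, the sum of `c(g, kg)` over `k < p^{m_p}` telescopes to `p^{m_p} h(g) - h(eᵢ)`, and its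
residue modulo `p^{m_p}` is the coordinate in the model. Characters of `ℤ[1/𝒫ᵐ]ᵈ/ℤᵈ` supply a
continuous section (`characterCocycle`).

Abstract structure: in `R = ∏ₚ ℤ/p^{m_p}` let `T` consist of the families with a nonzero multiple in
`ℤ`. Then `R/T` is uniquely divisible of size continuum, and `T/ℤ` is the sum of all Prüfer groups.
This sum is divisible, so it splits off (`exists_splitting`), and the resulting group does not
depend on `m`.

Definable rigidity: a Borel lift of an isomorphism fails to be additive only by elements of a
countable group, so one defect occurs on a set of positive measure. A density argument and a
majority vote then give a true homomorphism `g` on an open subgroup that still induces the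
isomorphism (`exists_hom_lift_on_open_subgroup`). Comparing `p`-torsion through `g`, injectivity
forces `m_p ≤ m'_p` for all large `p` (`exponent_le_of_local_lift`). Surjectivity forbids `m_p <
m'_p` at infinitely many `p` (`finite_setOf_exponent_lt`), by a diagonal argument against the
integers.

Conversely, if `m =* m'`, then multiplication by a rational with valuations `m_p - m'_p` identifies
the two groups `ℤ[1/𝒫ᵐ]ᵈ`, and hence their `Ext` groups. -/

theorem measurable_borel_of_continuous {X Y : Type*} [TopologicalSpace X] [TopologicalSpace Y]
    {f : X → Y} (hf : Continuous f) : @Measurable X Y (borel X) (borel Y) f := by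
  borelize X Y
  exact hf.measurable

/-- Some isomorphism between `X` and `Y` is definable together with its inverse. -/
def BidefinablyIsomorphic (X Y : PolishCover) : Prop :=
  ∃ (f : X.Quot ≃+ Y.Quot) (φ : X.G → Y.G) (ψ : Y.G → X.G),
    @Measurable X.G Y.G (borel X.G) (borel Y.G) φ ∧
    @Measurable Y.G X.G (borel Y.G) (borel X.G) ψ ∧
    (∀ x : X.G, f (QuotientAddGroup.mk x) = QuotientAddGroup.mk (φ x)) ∧
    ∀ y : Y.G, f.symm (QuotientAddGroup.mk y) = QuotientAddGroup.mk (ψ y)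

/-- `DefinablyIsomorphic` asks for a lift in one direction only, so its symmetry is not immediate.
The comparisons with the model carry both lifts in order to be usable either way. -/
theorem BidefinablyIsomorphic.symm {X Y : PolishCover} (h : BidefinablyIsomorphic X Y) :
    BidefinablyIsomorphic Y X := by
  obtain ⟨f, φ, ψ, hφ, hψ, h1, h2⟩ := h
  exact ⟨f.symm, ψ, φ, hψ, hφ, h2, h1⟩

theorem BidefinablyIsomorphic.definablyIsomorphic {X Y : PolishCover}
    (h : BidefinablyIsomorphic X Y) : DefinablyIsomorphic X Y := by
  obtain ⟨f, φ, ψ, hφ, hψ, h1, h2⟩ := h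
  exact ⟨f, φ, hφ, h1⟩

theorem DefinablyIsomorphic.refl (X : PolishCover) : DefinablyIsomorphic X X :=
  ⟨AddEquiv.refl _, id, @measurable_id _ (borel X.G), fun _ => rfl⟩

theorem DefinablyIsomorphic.trans {X Y Z : PolishCover} (h : DefinablyIsomorphic X Y)
    (h' : DefinablyIsomorphic Y Z) : DefinablyIsomorphic X Z := by
  obtain ⟨f, φ, hφ, h1⟩ := h
  obtain ⟨f', φ', hφ', h1'⟩ := h'
  exact ⟨f.trans f', φ' ∘ φ, @Measurable.comp _ _ _ (borel X.G) (borel Y.G) (borel Z.G) _ _ hφ' hφ,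
    fun x => by simp [h1, h1']⟩

theorem DefinablyIsomorphic.abstractlyIsomorphic {X Y : PolishCover}
    (h : DefinablyIsomorphic X Y) : AbstractlyIsomorphic X Y := by
  obtain ⟨f, _⟩ := h
  exact ⟨f⟩

/-- A homomorphism of the covering groups with a Borel right inverse that pulls the Polishable
subgroup back to the Polishable subgroup induces a definable isomorphism with definable inverse. -/
theorem bidefinablyIsomorphic_of_rightInverse {X Y : PolishCover} (α : X.G →+ Y.G)
    (hα : @Measurable X.G Y.G (borel X.G) (borel Y.G) α) (hN : ∀ x, α x ∈ Y.N ↔ x ∈ X.N)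
    (β : Y.G → X.G) (hβ : @Measurable Y.G X.G (borel Y.G) (borel X.G) β)
    (hαβ : ∀ y, α (β y) = y) : BidefinablyIsomorphic X Y := by
  let f : X.Quot →+ Y.Quot := QuotientAddGroup.map _ _ α fun x hx => (hN x).2 hx
  have hf : ∀ x : X.G, f (QuotientAddGroup.mk x) = QuotientAddGroup.mk (α x) := fun x => rfl
  have hb : Function.Bijective f := by
    refine ⟨(injective_iff_map_eq_zero f).2 fun q => ?_, fun q => ?_⟩
    · induction q using QuotientAddGroup.induction_on with
      | H x =>
        rw [hf, QuotientAddGroup.eq_zero_iff, QuotientAddGroup.eq_zero_iff]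
        exact (hN x).1
    · induction q using QuotientAddGroup.induction_on with
      | H y => exact ⟨QuotientAddGroup.mk (β y), by rw [hf, hαβ]⟩
  refine ⟨AddEquiv.ofBijective f hb, α, β, hα, hβ, fun x => rfl, fun y => ?_⟩
  rw [AddEquiv.symm_apply_eq]
  simp [hf, hαβ]

/-- A continuous bijective homomorphism of the covering groups that matches the Polishable
subgroups induces a definable isomorphism with definable inverse. -/
theorem bidefinablyIsomorphic_of_bijective {X Y : PolishCover} (α : X.G →+ Y.G)
    (hα : Continuous α) (hb : Function.Bijective α) (hN : ∀ x, α x ∈ Y.N ↔ x ∈ X.N) :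
    BidefinablyIsomorphic X Y := by
  let e := Equiv.ofBijective α hb
  refine bidefinablyIsomorphic_of_rightInverse α (measurable_borel_of_continuous hα) hN e.symm ?_
    (fun y => e.apply_symm_apply y)
  -- Lusin–Souslin: a continuous injection between Polish spaces maps Borel sets to Borel sets, so
  -- the inverse bijection is Borel.
  have hemb : @MeasurableEmbedding X.G Y.G (borel X.G) (borel Y.G) α := by
    borelize X.G Y.G
    exact hα.measurableEmbedding hb.1
  borelize X.G Y.G
  intro s hs
  rw [← Equiv.image_eq_preimage_symm]
  exact hemb.measurableSet_image' hs

/-! ### The model `∏ₚ (ℤ/p^{m_p})ᵈ` modulo the diagonal copy of `ℤᵈ` -/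

theorem neZero_prime (p : Nat.Primes) : NeZero (p : ℕ) := ⟨p.2.ne_zero⟩

theorem fact_prime (p : Nat.Primes) : Fact (p : ℕ).Prime := ⟨p.2⟩

attribute [local instance] neZero_prime fact_prime

/-- The profinite group `∏ₚ (ℤ/p^{m_p})ᵈ`. -/
abbrev Residues (d : ℕ) (m : Nat.Primes → ℕ+) : Type :=
  (p : Nat.Primes) → Fin d → ZMod ((p : ℕ) ^ (m p : ℕ))

instance (d : ℕ) (m : Nat.Primes → ℕ+) : PolishSpace (Residues d m) := by
  have : ∀ p : Nat.Primes, Finite (Fin d → ZMod ((p : ℕ) ^ (m p : ℕ))) := fun p => inferInstance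
  infer_instance

/-- The diagonal embedding of `ℤᵈ`. -/
def diag (d : ℕ) (m : Nat.Primes → ℕ+) : (Fin d → ℤ) →+ Residues d m where
  toFun z _ i := z i
  map_zero' := by ext; simp
  map_add' x y := by ext; simp

theorem diag_apply {d : ℕ} {m : Nat.Primes → ℕ+} (z : Fin d → ℤ) (p : Nat.Primes) (i : Fin d) :
    diag d m z p i = (z i : ZMod ((p : ℕ) ^ (m p : ℕ))) := rfl

/-- The group with a Polish cover `∏ₚ (ℤ/p^{m_p})ᵈ / ℤᵈ`. -/
def modelCover (d : ℕ) (m : Nat.Primes → ℕ+) : PolishCover :=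
  haveI : Countable (diag d m).range := (Set.countable_range (diag d m)).to_subtype
  { G := Residues d m
    N := (diag d m).range
    polishable := isPolishable_of_countable _ }

theorem intCast_residue_eq_zero_iff (m : Nat.Primes → ℕ+) (p : Nat.Primes) (z : ℤ) :
    (z : ZMod ((p : ℕ) ^ (m p : ℕ))) = 0 ↔ ((p : ℕ) : ℤ) ^ (m p : ℕ) ∣ z := by
  rw [ZMod.intCast_zmod_eq_zero_iff_dvd]
  push_cast
  rfl

/-- The primes below `n`. -/
def primesLT (n : ℕ) : Finset Nat.Primes := Finset.subtype Nat.Prime (Finset.range n)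

theorem mem_primesLT {n : ℕ} {p : Nat.Primes} : p ∈ primesLT n ↔ (p : ℕ) < n :=
  Finset.mem_subtype.trans Finset.mem_range

/-- Chinese remainder theorem: with `M` the product of the other prime powers below `n`, take `M`
times an inverse of `M` modulo `p^{m_p}`. Nothing is claimed at other primes `q ≥ n`. -/
theorem exists_idempotent (m : Nat.Primes → ℕ+) (n : ℕ) (p : Nat.Primes) : ∃ u : ℤ,
    (u : ZMod ((p : ℕ) ^ (m p : ℕ))) = 1 ∧ ∀ q : Nat.Primes, (q : ℕ) < n → q ≠ p →
      (u : ZMod ((q : ℕ) ^ (m q : ℕ))) = 0 := by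
  classical
  let F := (primesLT n).erase p
  let M : ℕ := ∏ q ∈ F, (q : ℕ) ^ (m q : ℕ)
  have hM : Nat.Coprime M ((p : ℕ) ^ (m p : ℕ)) := by
    refine Nat.Coprime.prod_left fun q hq => Nat.Coprime.pow _ _ ?_
    exact (Nat.coprime_primes q.2 p.2).2 fun h => (Finset.mem_erase.1 hq).1 (Subtype.ext h)
  refine ⟨M * (((M : ZMod ((p : ℕ) ^ (m p : ℕ)))⁻¹).val : ℕ), ?_, fun q hq hqp => ?_⟩
  · push_cast
    rw [ZMod.natCast_val, ZMod.cast_id]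
    exact ZMod.coe_mul_inv_eq_one _ hM
  · rw [intCast_residue_eq_zero_iff]
    refine Dvd.dvd.mul_right ?_ _
    have : (q : ℕ) ^ (m q : ℕ) ∣ M :=
      Finset.dvd_prod_of_mem (fun q : Nat.Primes => (q : ℕ) ^ (m q : ℕ))
        (Finset.mem_erase.2 ⟨hqp, mem_primesLT.2 hq⟩)
    exact_mod_cast this

/-- An integer vector that approximates `x` at all primes below `n`. -/
noncomputable def approx {d : ℕ} {m : Nat.Primes → ℕ+} (n : ℕ) (x : Residues d m) : Fin d → ℤ :=
  fun i => ∑ p ∈ primesLT n,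
    ((x p i).val : ℤ) * (exists_idempotent m n p).choose

theorem approx_cast {d : ℕ} {m : Nat.Primes → ℕ+} (n : ℕ) (x : Residues d m) {p : Nat.Primes}
    (hp : (p : ℕ) < n) (i : Fin d) :
    ((approx n x i : ℤ) : ZMod ((p : ℕ) ^ (m p : ℕ))) = x p i := by
  have hmem : p ∈ primesLT n :=
    mem_primesLT.2 hp
  rw [approx, Int.cast_sum, Finset.sum_eq_single_of_mem p hmem]
  · rw [Int.cast_mul, (exists_idempotent m n p).choose_spec.1, mul_one, Int.cast_natCast,
      ZMod.natCast_val, ZMod.cast_id]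
  · intro q hq hqp
    rw [Int.cast_mul, (exists_idempotent m n q).choose_spec.2 p hp hqp.symm, mul_zero]

theorem continuous_approx {d : ℕ} {m : Nat.Primes → ℕ+} (n : ℕ) :
    Continuous (approx n : Residues d m → Fin d → ℤ) := by
  refine continuous_pi fun i => continuous_finsetSum _ fun p _ => ?_
  have h : Continuous fun x : Residues d m => x p i :=
    (continuous_apply i).comp (continuous_apply p)
  exact (continuous_of_discreteTopology
    (f := fun t : ZMod ((p : ℕ) ^ (m p : ℕ)) => (t.val : ℤ) * (exists_idempotent m n p).choose)).comp h

/-- Some prime `q ≥ n` exceeds `|z|`. Thus an integer is determined by its residues at all but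
finitely many primes. -/
theorem int_eq_zero_of_forall_dvd {m : Nat.Primes → ℕ+} {z : ℤ} (n : ℕ)
    (h : ∀ q : Nat.Primes, n ≤ q → ((q : ℕ) : ℤ) ^ (m q : ℕ) ∣ z) : z = 0 := by
  obtain ⟨q, hq, hp⟩ := Nat.exists_infinite_primes (max n (z.natAbs + 1))
  refine Int.eq_zero_of_dvd_of_natAbs_lt_natAbs
    ((dvd_pow_self _ (m ⟨q, hp⟩).pos.ne').trans (h ⟨q, hp⟩ ((le_max_left _ _).trans hq))) ?_
  have := (le_max_right n (z.natAbs + 1)).trans hq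
  simp only [Int.natAbs_natCast]
  omega

/-! ### Borel lifts of homomorphisms with countable defect -/

section Rigidity

open MeasureTheory ENNReal

/-- A set of positive measure has density close to `1` in some coset of a basic open subgroup. -/
theorem exists_coset_density {K : Type*} [AddCommGroup K] [TopologicalSpace K]
    [IsTopologicalAddGroup K] [MeasurableSpace K] [BorelSpace K] (μ : Measure K)
    [IsFiniteMeasure μ] [μ.OuterRegular] [μ.IsAddLeftInvariant] (L : ℕ → AddSubgroup K)
    (hopen : ∀ n, IsOpen (L n : Set K)) (hanti : Antitone L)
    (hbasis : ∀ U ∈ 𝓝 (0 : K), ∃ n, (L n : Set K) ⊆ U) [∀ n, Countable (K ⧸ L n)]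
    {E : Set K} (hpos : 0 < μ E) {r : ℝ≥0∞} (hr0 : 0 < r) (hr : r < 1) :
    ∃ n a, r * μ (L n) < μ (E ∩ {x | -a + x ∈ L n}) := by
  by_contra! h
  -- If every coset has density at most `r`, then `μ E ≤ r μ U` for each open `U ⊇ E`. Outer
  -- regularity provides a `U` that violates this.
  obtain ⟨U, hEU, hU, hUr⟩ := E.exists_isOpen_lt_of_lt (μ := μ) (μ E / r) (by
    rw [ENNReal.lt_div_iff_mul_lt (Or.inl hr0.ne') (Or.inl (hr.trans one_lt_top).ne)]
    calc μ E * r < μ E * 1 := by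
          rw [ENNReal.mul_lt_mul_iff_right hpos.ne' (measure_ne_top _ _)]; exact hr
      _ = μ E := mul_one _)
  rw [ENNReal.lt_div_iff_mul_lt (Or.inl hr0.ne') (Or.inl (hr.trans one_lt_top).ne)] at hUr
  refine absurd hUr (not_lt.2 ?_)
  -- The union of the cosets of `L n` that lie inside `U`. Summing the density bound over these
  -- cosets bounds `μ (E ∩ V n)`, and these sets exhaust `E` because the `L n` form a basis at `0`.
  let V : ℕ → Set K := fun n => {x | ∀ l ∈ L n, x + l ∈ U}
  have hcoset : ∀ n a, MeasurableSet {x | -a + x ∈ L n} := fun n a =>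
    ((hopen n).preimage (continuous_const_add (-a))).measurableSet
  have hμcoset : ∀ n a, μ {x | -a + x ∈ L n} = μ (L n) := fun n a =>
    measure_preimage_add μ (-a) (L n : Set K)
  have hfib : ∀ n a, (QuotientAddGroup.mk ⁻¹' {(QuotientAddGroup.mk a : K ⧸ L n)} : Set K) =
      {x | -a + x ∈ L n} := by
    intro n a
    ext x
    simp only [Set.mem_preimage, Set.mem_singleton_iff, Set.mem_ofPred_eq]
    rw [eq_comm, QuotientAddGroup.eq]
  have hVmem : ∀ n a x, -a + x ∈ L n → (x ∈ V n ↔ a ∈ V n) := by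
    intro n a x hx
    constructor
    · intro hxV l hl
      have := hxV _ ((L n).sub_mem hl hx)
      rwa [show x + (l - (-a + x)) = a + l by abel] at this
    · intro haV l hl
      have := haV _ ((L n).add_mem hl hx)
      rwa [show a + (l + (-a + x)) = x + l by abel] at this
  have key : ∀ n, μ (E ∩ V n) ≤ μ U * r := by
    intro n
    have hsplit : ∀ S : Set K, μ S = ∑' q : K ⧸ L n, μ (S ∩ QuotientAddGroup.mk ⁻¹' {q}) := by
      intro S
      have hm : ∀ q : K ⧸ L n, MeasurableSet (QuotientAddGroup.mk ⁻¹' {q} : Set K) := by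
        intro q
        induction q using QuotientAddGroup.induction_on with
        | H a => rw [hfib]; exact hcoset n a
      have hd : Pairwise (Function.onFun Disjoint
          fun q : K ⧸ L n => (QuotientAddGroup.mk ⁻¹' {q} : Set K)) := by
        intro q q' hqq'
        exact Disjoint.preimage _ (Set.disjoint_singleton.2 hqq')
      have := measure_iUnion (μ := μ.restrict S) hd hm
      rw [← Set.preimage_iUnion, Set.iUnion_of_singleton, Set.preimage_univ,
        Measure.restrict_apply_univ] at this
      rw [this]
      exact tsum_congr fun q => by rw [Measure.restrict_apply (hm q), Set.inter_comm]
    calc μ (E ∩ V n) = ∑' q : K ⧸ L n, μ (E ∩ V n ∩ QuotientAddGroup.mk ⁻¹' {q}) := hsplit _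
      _ ≤ ∑' q : K ⧸ L n, r * μ (V n ∩ QuotientAddGroup.mk ⁻¹' {q}) := by
          refine ENNReal.tsum_le_tsum fun q => ?_
          induction q using QuotientAddGroup.induction_on with
          | H a =>
            rw [hfib]
            by_cases ha : a ∈ V n
            · have hsub : V n ∩ {x | -a + x ∈ L n} = {x | -a + x ∈ L n} :=
                Set.inter_eq_right.2 fun x hx => (hVmem n a x hx).2 ha
              rw [Set.inter_assoc, hsub, hμcoset]
              exact h n a
            · have hsub : V n ∩ {x | -a + x ∈ L n} = ∅ := by
                ext x
                simp only [Set.mem_inter_iff, Set.mem_ofPred_eq, Set.mem_empty_iff_false, iff_false]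
                rintro ⟨hx, hx'⟩
                exact ha ((hVmem n a x hx').1 hx)
              rw [Set.inter_assoc, hsub]
              simp
      _ = r * μ (V n) := by rw [ENNReal.tsum_mul_left, ← hsplit]
      _ ≤ r * μ U := by
          gcongr
          intro x hx
          simpa using hx 0 (L n).zero_mem
      _ = μ U * r := mul_comm _ _
  have hVmono : Monotone fun n => E ∩ V n := fun a b hab =>
    Set.inter_subset_inter_right _ fun x hx l hl => hx l (hanti hab hl)
  have hcup : ⋃ n, E ∩ V n = E := by
    refine Set.Subset.antisymm (Set.iUnion_subset fun n => Set.inter_subset_left) fun x hx => ?_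
    have : (fun l => x + l) ⁻¹' U ∈ 𝓝 (0 : K) :=
      (continuous_const_add x).continuousAt.preimage_mem_nhds
        (by simpa using hU.mem_nhds (hEU hx))
    obtain ⟨n, hn⟩ := hbasis _ this
    exact Set.mem_iUnion.2 ⟨n, hx, fun l hl => hn hl⟩
  calc μ E = ⨆ n, μ (E ∩ V n) := by rw [← hVmono.measure_iUnion, hcup]
    _ ≤ μ U * r := iSup_le key

/-- A set of small measure in a square `H × H` has a small horizontal section. -/
theorem exists_small_section {K : Type*} [MeasurableSpace K] (μ : Measure K) [IsFiniteMeasure μ]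
    {H : Set K} (hH : MeasurableSet H) {D : Set (K × K)} (hD : MeasurableSet D)
    {r : ℝ≥0∞} (h : (μ.prod μ) (D ∩ H ×ˢ H) < r * μ H * μ H) :
    ∃ z ∈ H, μ {t | t ∈ H ∧ (t, z) ∈ D} < r * μ H := by
  by_contra! hcon
  refine absurd h (not_lt.2 ?_)
  rw [Measure.prod_apply_symm (hD.inter (hH.prod hH))]
  calc r * μ H * μ H = ∫⁻ _ in H, r * μ H ∂μ := by rw [setLIntegral_const]
    _ ≤ ∫⁻ z in H, μ ((fun x => (x, z)) ⁻¹' (D ∩ H ×ˢ H)) ∂μ := by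
        refine setLIntegral_mono' hH fun z hz => (hcon z hz).trans (measure_mono ?_)
        rintro t ⟨ht, htD⟩
        exact ⟨htD, ht, hz⟩
    _ ≤ _ := setLIntegral_le_lintegral _ _

/-- A homomorphism from a profinite abelian group to a quotient by a countable subgroup that has a
Borel lift is, on an open subgroup, induced by a homomorphism. -/
theorem exists_hom_lift_on_open_subgroup {K K' : Type*} [AddCommGroup K] [TopologicalSpace K]
    [IsTopologicalAddGroup K] [CompactSpace K] [PolishSpace K] [AddCommGroup K']
    [TopologicalSpace K'] [IsTopologicalAddGroup K'] [PolishSpace K'] (N : AddSubgroup K')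
    [Countable N] (f : K →+ K' ⧸ N) (φ : K → K') (hφ : @Measurable K K' (borel K) (borel K') φ)
    (hf : ∀ x, f x = QuotientAddGroup.mk (φ x)) (L : ℕ → AddSubgroup K)
    (hopen : ∀ n, IsOpen (L n : Set K)) (hanti : Antitone L)
    (hbasis : ∀ U ∈ 𝓝 (0 : K), ∃ n, (L n : Set K) ⊆ U) :
    ∃ (n : ℕ) (g : L n →+ K'), ∀ h : L n, QuotientAddGroup.mk (g h) = f h := by
  borelize K K'
  let μ : Measure K := Measure.addHaar
  have hrel : ∀ x y, φ (x + y) - φ x - φ y ∈ N := by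
    intro x y
    rw [← QuotientAddGroup.eq_zero_iff, QuotientAddGroup.mk_sub, QuotientAddGroup.mk_sub,
      ← hf, ← hf, ← hf, map_add]
    abel
  -- Pairs are sorted by the additive defect of `φ`. There are countably many defects, so one class
  -- is not null.
  let E : N → Set (K × K) := fun c => {p | φ (p.1 + p.2) = φ p.1 + φ p.2 + c}
  have hcup : ⋃ c, E c = Set.univ := by
    refine Set.eq_univ_of_forall fun p => Set.mem_iUnion.2 ⟨⟨_, hrel p.1 p.2⟩, ?_⟩
    show φ (p.1 + p.2) = φ p.1 + φ p.2 + (φ (p.1 + p.2) - φ p.1 - φ p.2)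
    abel
  obtain ⟨c, hc⟩ : ∃ c, 0 < (μ.prod μ) (E c) := by
    by_contra! h0
    have : (μ.prod μ) (⋃ c, E c) = 0 := measure_iUnion_null fun c => le_antisymm (h0 c) bot_le
    rw [hcup] at this
    exact (NeZero.ne ((μ.prod μ) Set.univ)) this
  have hopen2 : ∀ n, IsOpen (((L n).prod (L n) : AddSubgroup (K × K)) : Set (K × K)) := fun n => by
    rw [AddSubgroup.coe_prod]
    exact (hopen n).prod (hopen n)
  have : ∀ n, Countable ((K × K) ⧸ (L n).prod (L n)) := by
    intro n
    have : DiscreteTopology ((K × K) ⧸ (L n).prod (L n)) :=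
      QuotientAddGroup.discreteTopology (hopen2 n)
    exact (finite_of_compact_of_discrete).to_countable
  -- The constant `5/6` leaves bad pairs of density below `1/6`. Two translates of the bad set then
  -- stay below `1/3`, and three exceptional sets of density below `1/3` cannot cover `H`.
  obtain ⟨n, ⟨a, b⟩, hab⟩ := exists_coset_density (μ.prod μ) (fun n => (L n).prod (L n)) hopen2
    (fun i j hij => AddSubgroup.prod_mono (hanti hij) (hanti hij)) (fun U hU => by
      rw [show (0 : K × K) = (0, 0) from rfl, nhds_prod_eq, Filter.mem_prod_iff] at hU
      obtain ⟨U₁, h₁, U₂, h₂, hU⟩ := hU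
      obtain ⟨i, hi⟩ := hbasis U₁ h₁
      obtain ⟨j, hj⟩ := hbasis U₂ h₂
      refine ⟨max i j, fun p hp => hU ⟨hi ?_, hj ?_⟩⟩
      · exact hanti (le_max_left i j) hp.1
      · exact hanti (le_max_right i j) hp.2) hc (r := 5 / 6) (by norm_num) (by
      rw [ENNReal.div_lt_iff (by norm_num) (by norm_num)]; norm_num)
  set H : Set K := SetLike.coe (L n) with hHdef
  have hHm : MeasurableSet H := (hopen n).measurableSet
  have hHpos : μ H ≠ 0 := ((hopen n).measure_pos μ ⟨0, (L n).zero_mem⟩).ne'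
  have hHtop : μ H ≠ ∞ := measure_ne_top _ _
  rw [AddSubgroup.coe_prod, Measure.prod_prod] at hab
  let B : Set (K × K) := {p | φ (a + p.1 + (b + p.2)) ≠ φ (a + p.1) + φ (b + p.2) + c}
  have hBm : MeasurableSet B := by
    refine (measurableSet_eq_fun ?_ ?_).compl <;> fun_prop
  have hB : (μ.prod μ) (B ∩ H ×ˢ H) < 1 / 6 * μ H * μ H := by
    have h1 : (μ.prod μ) (Bᶜ ∩ H ×ˢ H) =
        (μ.prod μ) (E c ∩ {x | -(a, b) + x ∈ (L n).prod (L n)}) := by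
      rw [← measure_preimage_add (μ.prod μ) (a, b)
        (E c ∩ {x | -(a, b) + x ∈ (L n).prod (L n)})]
      congr 1
      ext ⟨x, y⟩
      simp [B, E, H, AddSubgroup.mem_prod]
    have h2 := measure_inter_add_sdiff (μ := μ.prod μ) (H ×ˢ H) hBm
    rw [Measure.prod_prod, Set.inter_comm, Set.sdiff_eq, Set.inter_comm (H ×ˢ H), h1] at h2
    rw [mul_assoc]
    generalize (μ.prod μ) (E c ∩ {x | -(a, b) + x ∈ (L n).prod (L n)}) = e at hab h2
    have hM : μ H * μ H ≠ ∞ := ENNReal.mul_ne_top hHtop hHtop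
    generalize μ H * μ H = M at hab h2 hM ⊢
    generalize (μ.prod μ) (B ∩ H ×ˢ H) = t at h2 ⊢
    have ht : t ≠ ∞ := fun h => hM (by rw [← h2, h, top_add])
    have he : e ≠ ∞ := fun h => hM (by rw [← h2, h, add_top])
    lift t to NNReal using ht
    lift e to NNReal using he
    lift M to NNReal using hM
    have e1 : (5 / 6 : ℝ≥0∞) = ((5 / 6 : NNReal) : ℝ≥0∞) := by norm_num
    have e2 : (1 / 6 : ℝ≥0∞) = ((1 / 6 : NNReal) : ℝ≥0∞) := by norm_num
    rw [e1] at hab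
    rw [e2]
    norm_cast at hab h2 ⊢
    rw [← NNReal.coe_lt_coe] at hab ⊢
    have h2' : (t : ℝ) + e = M := by exact_mod_cast h2
    push_cast at hab ⊢
    linarith
  have hmemH : ∀ x, x ∈ H ↔ x ∈ L n := fun x => Iff.rfl
  have htrans : ∀ h ∈ H, ∀ t, h + t ∈ H ↔ t ∈ H := fun h hh t => (L n).add_mem_cancel_left hh
  -- The difference `φ (a + h + t) - φ (a + t)` is almost independent of `t ∈ H`. For good pairs
  -- `(t, y)` and `(h + t, y)` the terms `c` and `φ (b + y)` cancel, and the difference depends on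
  -- `z = t + y` only.
  have hpop : ∀ h ∈ H, ∃ y, μ {t | t ∈ H ∧ φ (a + h + t) - φ (a + t) ≠ y} < 1 / 3 * μ H := by
    intro h hh
    let D : Set (K × K) := {p | φ (a + h + p.1) - φ (a + p.1) ≠
      φ (a + b + h + p.2) - φ (a + b + p.2)}
    have hDm : MeasurableSet D := by
      refine (measurableSet_eq_fun ?_ ?_).compl <;> fun_prop
    have hD : (μ.prod μ) (D ∩ H ×ˢ H) < 1 / 3 * μ H * μ H := by
      -- The shear `(t, y) ↦ (t, t + y)` preserves the product measure, so smallness can be checked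
      -- in the coordinates `(t, y)`.
      have hmp := measurePreserving_prod_add μ μ
      rw [← hmp.measure_preimage (hDm.inter (hHm.prod hHm)).nullMeasurableSet]
      have hsub : (fun z : K × K => (z.1, z.1 + z.2)) ⁻¹' (D ∩ H ×ˢ H) ⊆
          (B ∩ H ×ˢ H) ∪ (fun p => (h, 0) + p) ⁻¹' (B ∩ H ×ˢ H) := by
        rintro ⟨t, y⟩ ⟨hD1, htH, hyH⟩
        have hyH : y ∈ H := (htrans t htH y).1 hyH
        by_contra hnot
        simp only [Set.mem_union, Set.mem_inter_iff, Set.mem_preimage, not_or, not_and,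
          Set.mem_prod, Prod.mk_add_mk, zero_add] at hnot
        have n1 : (t, y) ∉ B := fun hb => hnot.1 hb htH hyH
        have n2 : (h + t, y) ∉ B := fun hb => hnot.2 hb ((htrans h hh t).2 htH) hyH
        simp only [B, Set.mem_ofPred_eq, not_not] at n1 n2
        apply hD1
        show φ (a + h + t) - φ (a + t) = φ (a + b + h + (t + y)) - φ (a + b + (t + y))
        rw [show a + b + h + (t + y) = a + (h + t) + (b + y) by abel,
          show a + b + (t + y) = a + t + (b + y) by abel, n1, n2, add_assoc a h t]
        abel
      calc _ ≤ _ := measure_mono hsub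
        _ ≤ _ := measure_union_le _ _
        _ = (μ.prod μ) (B ∩ H ×ˢ H) + (μ.prod μ) (B ∩ H ×ˢ H) := by
            rw [measure_preimage_add]
        _ < 1 / 6 * μ H * μ H + 1 / 6 * μ H * μ H := ENNReal.add_lt_add hB hB
        _ = 1 / 3 * μ H * μ H := by
            rw [← add_mul, ← add_mul]
            congr 2
            have e2 : (1 / 6 : ℝ≥0∞) = ((1 / 6 : NNReal) : ℝ≥0∞) := by norm_num
            have e3 : (1 / 3 : ℝ≥0∞) = ((1 / 3 : NNReal) : ℝ≥0∞) := by norm_num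
            rw [e2, e3, ← ENNReal.coe_add]
            norm_num
    obtain ⟨z, hz, hzD⟩ := exists_small_section μ hHm hDm hD
    exact ⟨φ (a + b + h + z) - φ (a + b + z), hzD⟩
  -- Majority vote: `g h` is the value taken by the difference for more than two thirds of all `t ∈
  -- H`.
  choose! g hg using hpop
  have hthird : 1 / 3 * μ H + 1 / 3 * μ H + 1 / 3 * μ H = μ H := by
    rw [← add_mul, ← add_mul]
    have e3 : (1 / 3 : ℝ≥0∞) = ((1 / 3 : NNReal) : ℝ≥0∞) := by norm_num
    rw [e3, ← ENNReal.coe_add, ← ENNReal.coe_add]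
    norm_num
  have hgood : ∀ S T R : Set K, μ S < 1 / 3 * μ H → μ T < 1 / 3 * μ H → μ R < 1 / 3 * μ H →
      ∃ t ∈ H, t ∉ S ∧ t ∉ T ∧ t ∉ R := by
    intro S T R hS hT hR
    by_contra! hcon
    have hsub : H ⊆ S ∪ T ∪ R := by
      intro t ht
      by_contra hnot
      simp only [Set.mem_union, not_or] at hnot
      exact hnot.2 (hcon t ht hnot.1.1 hnot.1.2)
    have := calc μ H ≤ μ (S ∪ T ∪ R) := measure_mono hsub
      _ ≤ μ (S ∪ T) + μ R := measure_union_le _ _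
      _ ≤ μ S + μ T + μ R := by gcongr; exact measure_union_le _ _
      _ < 1 / 3 * μ H + 1 / 3 * μ H + 1 / 3 * μ H :=
          ENNReal.add_lt_add (ENNReal.add_lt_add hS hT) hR
      _ = μ H := hthird
    exact lt_irrefl _ this
  have hgadd : ∀ h ∈ H, ∀ k ∈ H, g (h + k) = g h + g k := by
    intro h hh k hk
    have hhk : h + k ∈ H := (L n).add_mem hh hk
    have h2 := hg h hh
    rw [← measure_preimage_add μ k] at h2
    -- A single `t` is good for `h + k` and `k`, while `k + t` is good for `h`. The differences
    -- telescope.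
    obtain ⟨t, ht, t1, t2, t3⟩ := hgood _ _ _ (hg _ hhk) h2 (hg k hk)
    simp only [Set.mem_preimage, Set.mem_ofPred_eq, not_and, not_not, htrans k hk] at t1 t2 t3
    rw [← t1 ht, ← t2 ht, ← t3 ht, show a + (h + k) + t = a + h + (k + t) by abel,
      show a + (k + t) = a + k + t by abel]
    abel
  refine ⟨n, AddMonoidHom.mk' (fun h => g h) fun h k => hgadd h h.2 k k.2, fun h => ?_⟩
  -- One good `t` suffices: modulo `N`, the difference `φ (a + h + t) - φ (a + t)` represents `f h`.
  obtain ⟨t, ht, t1, -, -⟩ := hgood _ _ _ (hg h h.2) (hg h h.2) (hg h h.2)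
  simp only [Set.mem_ofPred_eq, not_and, not_not] at t1
  rw [AddMonoidHom.mk'_apply, ← t1 ht, QuotientAddGroup.mk_sub, ← hf, ← hf, ← map_sub]
  congr 1
  abel

end Rigidity

/-! ### Rigidity of the model -/

instance (d : ℕ) (m : Nat.Primes → ℕ+) : IsTopologicalAddGroup (Residues d m) :=
  (modelCover d m).isTopologicalAddGroup

/-- The open subgroup of the residue families that vanish at all primes below `n`. -/
def tail (d : ℕ) (m : Nat.Primes → ℕ+) (n : ℕ) : AddSubgroup (Residues d m) where
  carrier := {x | ∀ p ∈ primesLT n, x p = 0}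
  zero_mem' := fun _ _ => rfl
  add_mem' ha hb p hp := by rw [Pi.add_apply, ha p hp, hb p hp, add_zero]
  neg_mem' ha p hp := by rw [Pi.neg_apply, ha p hp, neg_zero]

theorem mem_tail {d : ℕ} {m : Nat.Primes → ℕ+} {n : ℕ} {x : Residues d m} :
    x ∈ tail d m n ↔ ∀ p ∈ primesLT n, x p = 0 := Iff.rfl

theorem isOpen_tail (d : ℕ) (m : Nat.Primes → ℕ+) (n : ℕ) :
    IsOpen (tail d m n : Set (Residues d m)) := by
  have : (tail d m n : Set (Residues d m)) = ⋂ p ∈ primesLT n, {x | x p = 0} := by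
    ext x
    simp only [SetLike.mem_coe, mem_tail, Set.mem_iInter, Set.mem_ofPred_eq]
  rw [this]
  refine isOpen_biInter_finset fun p _ => ?_
  have hc : Continuous fun x : Residues d m => x p := continuous_apply p
  exact (isOpen_discrete {(0 : Fin d → ZMod ((p : ℕ) ^ (m p : ℕ)))}).preimage hc

theorem antitone_tail (d : ℕ) (m : Nat.Primes → ℕ+) : Antitone (tail d m) :=
  fun _ _ hab _ hx p hp => hx p (mem_primesLT.2 ((mem_primesLT.1 hp).trans_le hab))

theorem exists_tail_subset {d : ℕ} {m : Nat.Primes → ℕ+} {U : Set (Residues d m)}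
    (hU : U ∈ 𝓝 0) : ∃ n, (tail d m n : Set (Residues d m)) ⊆ U := by
  rw [nhds_pi, Filter.mem_pi] at hU
  obtain ⟨I, hI, t, ht, hU⟩ := hU
  obtain ⟨n, hn⟩ := (hI.image fun p : Nat.Primes => (p : ℕ)).bddAbove
  refine ⟨n + 1, fun x hx => hU fun p hp => ?_⟩
  rw [hx p (mem_primesLT.2 (Nat.lt_succ_of_le (hn ⟨p, hp, rfl⟩)))]
  exact mem_of_mem_nhds (ht p)

/-- Each class of the model has a representative in `tail d m n`, so a lift on this open subgroup
still sees the whole quotient. -/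
theorem exists_add_diag_mem_tail {d : ℕ} {m : Nat.Primes → ℕ+} (n : ℕ) (x : Residues d m) :
    x - diag d m (approx n x) ∈ tail d m n := by
  intro p hp
  ext i
  rw [Pi.sub_apply, Pi.sub_apply, diag_apply, approx_cast n x (mem_primesLT.1 hp), sub_self]
  rfl

theorem isUnit_natCast_residue (m : Nat.Primes → ℕ+) {p q : Nat.Primes} (hpq : q ≠ p) :
    IsUnit ((p : ℕ) : ZMod ((q : ℕ) ^ (m q : ℕ))) := by
  rw [ZMod.isUnit_iff_coprime]
  exact ((Nat.coprime_primes p.2 q.2).2 fun h => hpq (Subtype.ext h.symm)).pow_right _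

theorem eq_zero_of_prime_pow_smul_eq_zero {d : ℕ} {m : Nat.Primes → ℕ+} {x : Residues d m}
    {p q : Nat.Primes} (hpq : q ≠ p) {k : ℕ} (h : (p : ℕ) ^ k • x = 0) : x q = 0 := by
  ext i
  have := congrFun (congrFun h q) i
  rw [Pi.smul_apply, Pi.smul_apply, nsmul_eq_mul, Nat.cast_pow] at this
  exact ((isUnit_natCast_residue m hpq).pow k).mul_right_eq_zero.1 this

theorem prime_pow_smul_residue {d : ℕ} {m : Nat.Primes → ℕ+} (p : Nat.Primes)
    (y : Fin d → ZMod ((p : ℕ) ^ (m p : ℕ))) : (p : ℕ) ^ (m p : ℕ) • y = 0 := by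
  ext i
  rw [Pi.smul_apply, nsmul_eq_mul, ZMod.natCast_self, zero_mul]
  rfl

/-- The residue family supported at `p` with value `1` in the coordinate `i`. -/
def unitAt {d : ℕ} (m : Nat.Primes → ℕ+) (p : Nat.Primes) (i : Fin d) : Residues d m :=
  Pi.single p (Pi.single i 1)

/-- The unit vector `e` at `p` has order `p^{m_p}`, so `g e` is supported at `p` and is killed by
`p^{m'_p}`. By injectivity `p^{m'_p} e` comes from an integer vector; its `i`-th entry vanishes at
all other primes, hence is zero. -/
theorem exponent_le_of_local_lift {d : ℕ} {m m' : Nat.Primes → ℕ+} (i : Fin d)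
    (f : (modelCover d m).Quot →+ (modelCover d m').Quot) (hf : Function.Injective f) {n : ℕ}
    (g : tail d m n →+ Residues d m')
    (hg : ∀ h : tail d m n, (QuotientAddGroup.mk (g h) : (modelCover d m').Quot) =
      f (QuotientAddGroup.mk h.1)) {p : Nat.Primes} (hp : n ≤ p) : (m p : ℕ) ≤ m' p := by
  have hmem : unitAt m p i ∈ tail d m n := fun q hq =>
    Pi.single_eq_of_ne (fun h => absurd (mem_primesLT.1 hq) (by rw [h]; exact not_lt.2 hp)) _
  let e : tail d m n := ⟨unitAt m p i, hmem⟩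
  have he : (p : ℕ) ^ (m p : ℕ) • e = 0 := by
    ext1
    funext q
    show (p : ℕ) ^ (m p : ℕ) • unitAt m p i q = 0
    by_cases hq : q = p
    · subst hq
      exact prime_pow_smul_residue _ _
    · rw [unitAt, Pi.single_eq_of_ne hq, smul_zero]
  have hge : (p : ℕ) ^ (m' p : ℕ) • g e = 0 := by
    have h0 : (p : ℕ) ^ (m p : ℕ) • g e = 0 := by rw [← map_nsmul, he, map_zero]
    funext q
    by_cases hq : q = p
    · subst hq
      exact prime_pow_smul_residue _ _
    · rw [Pi.smul_apply, eq_zero_of_prime_pow_smul_eq_zero hq h0, smul_zero]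
      rfl
  have h1 : f (QuotientAddGroup.mk ((p : ℕ) ^ (m' p : ℕ) • unitAt m p i)) = 0 := by
    have := hg ((p : ℕ) ^ (m' p : ℕ) • e)
    rw [map_nsmul, hge] at this
    exact this.symm
  have h2 := (QuotientAddGroup.eq_zero_iff _).1 ((map_eq_zero_iff f hf).1 h1)
  obtain ⟨z, hz⟩ := h2
  have hz0 : z i = 0 := by
    refine int_eq_zero_of_forall_dvd (m := m) (p + 1) fun q hq => ?_
    rw [← intCast_residue_eq_zero_iff, ← diag_apply, hz, Pi.smul_apply, unitAt,
      Pi.single_eq_of_ne (fun h => by rw [h] at hq; omega), smul_zero]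
    rfl
  have h3 := congrFun (congrFun hz p) i
  rw [diag_apply, hz0, Pi.smul_apply, Pi.smul_apply, unitAt, Pi.single_eq_same,
    Pi.single_eq_same, nsmul_eq_mul, mul_one, Int.cast_zero, eq_comm,
    ZMod.natCast_eq_zero_iff] at h3
  exact (Nat.pow_dvd_pow_iff_le_right p.2.one_lt).1 h3

/-- Multiplying `h` by `p^{m_p}` kills its `p`-component, and `p` is a unit elsewhere, so the
product is divisible by `p^{m'_p}` within the tail. Hence `p^{m_p}` kills the `p`-component of `g h`
in `ℤ/p^{m'_p}`, which makes that component a multiple of `p` when `m_p < m'_p`. -/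
theorem cast_eq_zero_of_local_lift {d : ℕ} {m m' : Nat.Primes → ℕ+} {n : ℕ}
    (g : tail d m n →+ Residues d m') (h : tail d m n) {p : Nat.Primes} (hp : m p < m' p)
    (i : Fin d) : ZMod.castHom (dvd_pow_self (p : ℕ) (m' p).pos.ne') (ZMod p) (g h p i) = 0 := by
  have hw : ∃ w : tail d m n, (p : ℕ) ^ (m p : ℕ) • h = (p : ℕ) ^ (m' p : ℕ) • w := by
    -- At `q = p` the inverse is a junk value, but the factor `p^{m_p}` is zero there.
    refine ⟨⟨fun q i => (p : ZMod _) ^ (m p : ℕ) * ((p : ZMod _) ^ (m' p : ℕ))⁻¹ * h.1 q i,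
      fun q hq => ?_⟩, ?_⟩
    · funext i
      show _ * h.1 q i = 0
      rw [h.2 q hq]
      exact mul_zero _
    · ext q i
      show (p : ℕ) ^ (m p : ℕ) • h.1 q i = (p : ℕ) ^ (m' p : ℕ) •
        ((p : ZMod _) ^ (m p : ℕ) * ((p : ZMod _) ^ (m' p : ℕ))⁻¹ * h.1 q i)
      rw [nsmul_eq_mul, nsmul_eq_mul]
      by_cases hq : q = p
      · subst hq
        have h0 : (((q : ℕ) ^ (m q : ℕ) : ℕ) : ZMod ((q : ℕ) ^ (m q : ℕ))) = 0 :=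
          ZMod.natCast_self _
        push_cast at h0 ⊢
        rw [h0]
        simp
      · have hu := ZMod.mul_inv_of_unit _ ((isUnit_natCast_residue m hq).pow (m' p))
        push_cast
        linear_combination (-(p : ZMod _) ^ (m p : ℕ) * h.1 q i) * hu
  obtain ⟨w, hw⟩ := hw
  have h1 := congrFun (congrFun (congrArg g hw) p) i
  rw [map_nsmul, map_nsmul, Pi.smul_apply, Pi.smul_apply, Pi.smul_apply,
    prime_pow_smul_residue, Pi.zero_apply, nsmul_eq_mul] at h1
  obtain ⟨t, ht⟩ := ZMod.intCast_surjective (g h p i)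
  rw [← ht] at h1 ⊢
  rw [map_intCast, ZMod.intCast_zmod_eq_zero_iff_dvd]
  have h2 : (((p : ℕ) ^ (m p : ℕ) * t : ℤ) : ZMod ((p : ℕ) ^ (m' p : ℕ))) = 0 := by
    push_cast at h1 ⊢
    exact h1
  rw [intCast_residue_eq_zero_iff, show (m' p : ℕ) = m p + (m' p - m p) from
    (Nat.add_sub_cancel' (le_of_lt hp)).symm, pow_add] at h2
  have h3 := (mul_dvd_mul_iff_left (pow_ne_zero _ (by exact_mod_cast p.2.ne_zero))).1 h2
  exact (dvd_pow_self _ (Nat.sub_pos_of_lt hp).ne').trans h3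

/-- At the primes in question every value of `g` vanishes modulo `p`, so a class in the range of `f`
is there congruent modulo `p` to one integer vector. With infinitely many such primes, a family can
be built that escapes every integer. -/
theorem finite_setOf_exponent_lt {d : ℕ} {m m' : Nat.Primes → ℕ+} (i : Fin d)
    (f : (modelCover d m).Quot →+ (modelCover d m').Quot) (hf : Function.Surjective f) {n : ℕ}
    (g : tail d m n →+ Residues d m')
    (hg : ∀ h : tail d m n, (QuotientAddGroup.mk (g h) : (modelCover d m').Quot) =
      f (QuotientAddGroup.mk h.1)) : {p | m p < m' p}.Finite := by
  by_contra hinf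
  have : Infinite {p | m p < m' p} := Set.infinite_coe_iff.2 hinf
  obtain ⟨σ⟩ : Nonempty ({p | m p < m' p} ≃ ℤ) := nonempty_equiv_of_countable
  classical
  -- Diagonalization: every integer `z` has its own prime `σ⁻¹ z`, where `y` takes the value `z +
  -- 1`.
  let y : Residues d m' := fun p _ =>
    if hp : m p < m' p then ((σ ⟨p, hp⟩ + 1 : ℤ) : ZMod _) else 0
  obtain ⟨q, hq⟩ := hf (QuotientAddGroup.mk y)
  induction q using QuotientAddGroup.induction_on with
  | H x =>
    let h : tail d m n := ⟨_, exists_add_diag_mem_tail n x⟩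
    have h1 : (QuotientAddGroup.mk (g h) : (modelCover d m').Quot) = QuotientAddGroup.mk y := by
      refine (hg h).trans (Eq.trans (congrArg f (QuotientAddGroup.eq.2 ?_)) hq)
      refine ⟨approx n x, ?_⟩
      have hx : ∀ v w : Residues d m, w = -(v - w) + v := fun v w => by abel
      exact hx x (diag d m (approx n x))
    obtain ⟨z, hz⟩ := QuotientAddGroup.eq.1 h1
    let p := σ.symm (z i)
    have h2 := congrFun (congrFun hz p.1) i
    have hy : y p.1 i = ((z i + 1 : ℤ) : ZMod _) := by
      refine (dif_pos p.2).trans ?_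
      simp [p]
    change diag d m' z p.1 i = -(g h p.1 i) + y p.1 i at h2
    rw [hy, diag_apply] at h2
    -- Modulo `p` the term from `g` disappears, which leaves `z i = z i + 1`.
    have h3 := congrArg (ZMod.castHom (dvd_pow_self (p.1 : ℕ) (m' p.1).pos.ne') (ZMod p.1)) h2
    rw [map_add, map_neg, cast_eq_zero_of_local_lift g h p.2 i, map_intCast, map_intCast] at h3
    push_cast at h3
    simp at h3

theorem eqStar_of_definablyIsomorphic_modelCover {d : ℕ} (hd : 1 ≤ d) {m m' : Nat.Primes → ℕ+}
    (h : DefinablyIsomorphic (modelCover d m) (modelCover d m')) : EqStar m m' := by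
  obtain ⟨f, φ, hφ, hf⟩ := h
  have : Countable (diag d m').range := (Set.countable_range (diag d m')).to_subtype
  let F : Residues d m →+ Residues d m' ⧸ (diag d m').range :=
    f.toAddMonoidHom.comp (QuotientAddGroup.mk' (diag d m).range)
  have key := exists_hom_lift_on_open_subgroup (K := Residues d m) (K' := Residues d m')
  obtain ⟨n, g, hg⟩ := key (diag d m').range F φ hφ
    (fun x => hf x) (tail d m) (isOpen_tail d m) (antitone_tail d m)
    (fun U hU => exists_tail_subset hU)
  let i : Fin d := ⟨0, hd⟩
  have h1 := finite_setOf_exponent_lt i f.toAddMonoidHom f.surjective g hg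
  refine ((primesLT n).finite_toSet.union h1).subset fun p hp => ?_
  by_cases hpn : (p : ℕ) < n
  · exact Or.inl (mem_primesLT.2 hpn)
  · refine Or.inr (lt_of_le_of_ne ?_ hp)
    exact exponent_le_of_local_lift i f.toAddMonoidHom f.injective g hg (not_lt.1 hpn)

/-! ### Pairing integer vectors with `ℤ[1/𝒫ᵐ]ᵈ` -/

theorem one_div_mem_invPrimes (m : Nat.Primes → ℕ+) (p : Nat.Primes) :
    (1 / (p : ℚ) ^ (m p : ℕ) : ℚ) ∈ invPrimes m := by
  refine ⟨1, (p : ℕ) ^ (m p : ℕ), pow_pos p.2.pos _, fun q k hk => ?_, by push_cast; rfl⟩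
  rcases Nat.eq_zero_or_pos k with rfl | hk0
  · exact Nat.zero_le _
  · have hqp : q = p := by
      have := q.2.dvd_of_dvd_pow ((dvd_pow_self _ hk0.ne').trans hk)
      exact Subtype.ext ((Nat.prime_dvd_prime_iff_eq q.2 p.2).1 this)
    subst hqp
    exact (Nat.pow_dvd_pow_iff_le_right q.2.one_lt).1 hk

/-- For `q = a/b` each prime power dividing `b` divides some `p^{m_p}` with `p ≤ b`. The congruences
at primes below `b + 1` therefore force `b ∣ z`. -/
theorem exists_bound_mul_mem_int {m : Nat.Primes → ℕ+} {q : ℚ} (hq : q ∈ invPrimes m) :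
    ∃ B : ℕ, ∀ z : ℤ, (∀ p ∈ primesLT B, (z : ZMod ((p : ℕ) ^ (m p : ℕ))) = 0) →
      ∃ k : ℤ, (z : ℚ) * q = k := by
  obtain ⟨a, b, hb, h, rfl⟩ := hq
  refine ⟨b + 1, fun z hz => ?_⟩
  have hbz : (b : ℤ) ∣ z := by
    rw [Int.natCast_dvd, Nat.dvd_iff_prime_pow_dvd_dvd]
    intro p k hp hk
    rcases Nat.eq_zero_or_pos k with rfl | hk0
    · exact one_dvd _
    · have hpb : p ≤ b := Nat.le_of_dvd hb ((dvd_pow_self p hk0.ne').trans hk)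
      have h1 := (intCast_residue_eq_zero_iff m ⟨p, hp⟩ z).1
        (hz ⟨p, hp⟩ (mem_primesLT.2 (Nat.lt_succ_of_le hpb)))
      rw [← Int.natCast_dvd]
      push_cast
      exact (pow_dvd_pow _ (h ⟨p, hp⟩ k hk)).trans h1
  obtain ⟨c, rfl⟩ := hbz
  refine ⟨c * a, ?_⟩
  have hb0 : (b : ℚ) ≠ 0 := by exact_mod_cast hb.ne'
  push_cast
  field_simp

theorem exists_bound_pairing_mem_int {d : ℕ} {m : Nat.Primes → ℕ+} {x : Fin d → ℚ}
    (hx : x ∈ invPrimesPow d m) : ∃ B : ℕ, ∀ z : Fin d → ℤ,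
      (∀ p ∈ primesLT B, ∀ i, (z i : ZMod ((p : ℕ) ^ (m p : ℕ))) = 0) →
      ∃ k : ℤ, ∑ i, (z i : ℚ) * x i = k := by
  have h := fun i => exists_bound_mul_mem_int (hx i (Set.mem_univ i))
  choose B hB using h
  refine ⟨Finset.univ.sup B, fun z hz => ?_⟩
  have h' : ∀ i, ∃ k : ℤ, (z i : ℚ) * x i = k := fun i => hB i (z i) fun p hp =>
    hz p (mem_primesLT.2 ((mem_primesLT.1 hp).trans_le (Finset.le_sup (Finset.mem_univ i)))) i
  choose k hk using h'
  exact ⟨∑ i, k i, by push_cast; exact Finset.sum_congr rfl fun i _ => hk i⟩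

/-! ### The profinite completion and the model -/

section Completion

variable {d : ℕ} {m : Nat.Primes → ℕ+} (A : Cofiltration (invPrimesPow d m))

/-- One half of the cofinality between the dual filtration and the congruence subgroups. Finite
generation of the term leaves only finitely many bounds to satisfy. -/
theorem Cofiltration.exists_bound_mem_dual (n : ℕ) : ∃ B : ℕ, ∀ z : Fin d → ℤ,
    (∀ p ∈ primesLT B, ∀ i, (z i : ZMod ((p : ℕ) ^ (m p : ℕ))) = 0) → z ∈ A.dual n := by
  obtain ⟨S, hS⟩ := A.fg n
  have h : ∀ y : S, ∃ B : ℕ, ∀ z : Fin d → ℤ,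
      (∀ p ∈ primesLT B, ∀ i, (z i : ZMod ((p : ℕ) ^ (m p : ℕ))) = 0) →
      ∃ k : ℤ, ∑ i, (z i : ℚ) * y.1 i = k := fun y =>
    exists_bound_pairing_mem_int ((A.mem_iff _).2 ⟨n, hS ▸ AddSubgroup.subset_closure y.2⟩)
  choose B hB using h
  refine ⟨Finset.univ.sup B, fun z hz y hy => ?_⟩
  rw [← hS] at hy
  induction hy using AddSubgroup.closure_induction with
  | mem y hy => exact hB ⟨y, hy⟩ z fun p hp => hz p (mem_primesLT.2
      ((mem_primesLT.1 hp).trans_le (Finset.le_sup (Finset.mem_univ (⟨y, hy⟩ : S)))))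
  | zero => exact ⟨0, by simp⟩
  | add a b _ _ ha hb =>
    obtain ⟨k, hk⟩ := ha
    obtain ⟨l, hl⟩ := hb
    exact ⟨k + l, by simp [mul_add, Finset.sum_add_distrib, hk, hl]⟩
  | neg a _ ha =>
    obtain ⟨k, hk⟩ := ha
    exact ⟨-k, by simp [hk]⟩

/-- The other half of the cofinality: the vectors `eᵢ/p^{m_p}` all lie in some term, and pairing `z`
with them gives `zᵢ/p^{m_p}`. -/
theorem Cofiltration.exists_dual_cast_eq_zero (p : Nat.Primes) :
    ∃ n, ∀ z ∈ A.dual n, ∀ i, (z i : ZMod ((p : ℕ) ^ (m p : ℕ))) = 0 := by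
  have h : ∀ i : Fin d, ∃ n, (Pi.single i (1 / (p : ℚ) ^ (m p : ℕ)) : Fin d → ℚ) ∈ A.term n := by
    intro i
    refine (A.mem_iff _).1 fun j _ => ?_
    rcases eq_or_ne j i with rfl | hj
    · rw [Pi.single_eq_same]
      exact one_div_mem_invPrimes m p
    · rw [Pi.single_eq_of_ne hj]
      exact (invPrimes m).zero_mem
  choose n hn using h
  refine ⟨Finset.univ.sup n, fun z hz i => ?_⟩
  obtain ⟨k, hk⟩ := hz _ (A.mono (Finset.le_sup (Finset.mem_univ i)) (hn i))
  rw [Finset.sum_eq_single_of_mem i (Finset.mem_univ i) (fun j _ hj => by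
    rw [Pi.single_eq_of_ne hj, mul_zero]), Pi.single_eq_same] at hk
  rw [intCast_residue_eq_zero_iff]
  have hp : (p : ℚ) ^ (m p : ℕ) ≠ 0 := pow_ne_zero _ (by exact_mod_cast p.2.ne_zero)
  refine ⟨k, ?_⟩
  have : (z i : ℚ) = (p : ℚ) ^ (m p : ℕ) * k := by rw [← hk]; field_simp
  exact_mod_cast this

/-- A bound on the primes that matter for the `n`-th term of the dual filtration. -/
noncomputable def Cofiltration.bound (n : ℕ) : ℕ := (A.exists_bound_mem_dual n).choose

theorem Cofiltration.mk_eq_mk {n : ℕ} {z w : Fin d → ℤ}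
    (h : ∀ p : Nat.Primes, (p : ℕ) < A.bound n → ∀ i,
      (z i : ZMod ((p : ℕ) ^ (m p : ℕ))) = w i) :
    (QuotientAddGroup.mk z : (Fin d → ℤ) ⧸ A.dual n) = QuotientAddGroup.mk w := by
  rw [QuotientAddGroup.eq]
  refine (A.exists_bound_mem_dual n).choose_spec _ fun p hp i => ?_
  rw [Pi.add_apply, Pi.neg_apply, Int.cast_add, Int.cast_neg, h p (mem_primesLT.1 hp) i]
  exact neg_add_cancel _

theorem Cofiltration.mk_approx {n a : ℕ} (ha : A.bound n ≤ a) (x : Residues d m) :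
    (QuotientAddGroup.mk (approx a x) : (Fin d → ℤ) ⧸ A.dual n) =
      QuotientAddGroup.mk (approx (A.bound n) x) :=
  A.mk_eq_mk fun p hp i => by rw [approx_cast _ _ hp, approx_cast _ _ (hp.trans_le ha)]

/-- The isomorphism between `∏ₚ (ℤ/p^{m_p})ᵈ` and the profinite completion of `ℤᵈ`. -/
noncomputable def Cofiltration.ofResidues : Residues d m →+ A.completion where
  toFun x := ⟨fun n => QuotientAddGroup.mk (approx (A.bound n) x), fun n => by
    show QuotientAddGroup.mk (approx (A.bound (n + 1)) x) = QuotientAddGroup.mk _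
    -- The chosen bounds need not increase with `n`, so both levels are compared through the
    -- approximation at the larger bound.
    rw [← A.mk_approx (le_max_left (A.bound n) (A.bound (n + 1))), QuotientAddGroup.eq]
    refine annihilator_anti (A.mono n.le_succ) (QuotientAddGroup.eq.1 ?_)
    exact (A.mk_approx (le_max_right (A.bound n) (A.bound (n + 1))) x).symm⟩
  map_zero' := by
    ext n
    refine A.mk_eq_mk (w := 0) fun p hp i => ?_
    rw [approx_cast _ _ hp]
    simp
  map_add' x y := by
    ext n
    refine A.mk_eq_mk (w := approx (A.bound n) x + approx (A.bound n) y) fun p hp i => ?_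
    rw [approx_cast _ _ hp]
    show x p i + y p i = ((approx (A.bound n) x i + approx (A.bound n) y i : ℤ) : ZMod _)
    rw [Int.cast_add, approx_cast _ _ hp, approx_cast _ _ hp]

theorem Cofiltration.ofResidues_apply (x : Residues d m) (n : ℕ) :
    (A.ofResidues x).1 n = QuotientAddGroup.mk (approx (A.bound n) x) := rfl

theorem Cofiltration.continuous_ofResidues : Continuous A.ofResidues := by
  refine Continuous.subtype_mk (continuous_pi fun n => ?_) _
  exact (continuous_of_discreteTopology
    (f := fun z : Fin d → ℤ => (QuotientAddGroup.mk z : (Fin d → ℤ) ⧸ A.dual n))).comp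
      (continuous_approx (A.bound n))

theorem Cofiltration.ofResidues_diag (z : Fin d → ℤ) :
    A.ofResidues (diag d m z) = A.toCompletion z := by
  ext n
  exact A.mk_eq_mk fun p hp i => approx_cast _ _ hp i

theorem Cofiltration.injective_ofResidues : Function.Injective A.ofResidues := by
  refine (injective_iff_map_eq_zero _).2 fun x hx => ?_
  funext p
  ext i
  obtain ⟨n, hn⟩ := A.exists_dual_cast_eq_zero p
  have h1 : A.ofResidues x = 0 := hx
  have h2 : (QuotientAddGroup.mk (approx (max (A.bound n) (p + 1)) x) : (Fin d → ℤ) ⧸ A.dual n)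
      = 0 := by
    rw [A.mk_approx (le_max_left _ _), ← A.ofResidues_apply, h1]
    rfl
  have h3 := hn _ ((QuotientAddGroup.eq_zero_iff _).1 h2) i
  rwa [approx_cast _ _ (lt_of_lt_of_le (Nat.lt_succ_self _) (le_max_right _ _))] at h3

theorem Cofiltration.exists_mk_eq_of_le (ξ : A.completion) {n k : ℕ} (hnk : n ≤ k)
    {z : Fin d → ℤ} (hz : QuotientAddGroup.mk z = ξ.1 k) : QuotientAddGroup.mk z = ξ.1 n := by
  induction k, hnk using Nat.le_induction with
  | base => exact hz
  | succ k _ ih =>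
    refine ih ?_
    rw [← ξ.2 k, ← hz]
    rfl

theorem Cofiltration.surjective_ofResidues : Function.Surjective A.ofResidues := by
  intro ξ
  choose n hn using A.exists_dual_cast_eq_zero
  have hrep : ∀ k, ∃ z : Fin d → ℤ, QuotientAddGroup.mk z = ξ.1 k := fun k =>
    QuotientAddGroup.mk_surjective (ξ.1 k)
  choose z hz using hrep
  -- At level `n p` of the inverse system the residue modulo `p^{m_p}` is already determined.
  refine ⟨fun p i => (z (n p) i : ZMod _), ?_⟩
  ext k
  -- One integer vector, at a level beyond `k` and all relevant `n p`, represents `ξ` at all these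
  -- levels simultaneously.
  obtain ⟨l, hl⟩ : ∃ l, k ≤ l ∧ ∀ p ∈ primesLT (A.bound k), n p ≤ l :=
    ⟨max k ((primesLT (A.bound k)).sup n), le_max_left _ _,
      fun p hp => (Finset.le_sup hp).trans (le_max_right _ _)⟩
  rw [← A.exists_mk_eq_of_le ξ hl.1 (hz l)]
  refine A.mk_eq_mk fun p hp i => ?_
  rw [approx_cast _ _ hp]
  have h1 := A.exists_mk_eq_of_le ξ (hl.2 p (mem_primesLT.2 hp)) (hz l)
  rw [← hz (n p), QuotientAddGroup.eq] at h1
  have h2 := hn p _ h1 i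
  rw [Pi.add_apply, Pi.neg_apply, Int.cast_add, Int.cast_neg, neg_add_eq_zero] at h2
  exact h2.symm

theorem Cofiltration.bidefinablyIsomorphic_modelCover :
    BidefinablyIsomorphic (modelCover d m) A.completionCover := by
  refine bidefinablyIsomorphic_of_bijective (X := modelCover d m) (Y := A.completionCover)
    A.ofResidues A.continuous_ofResidues ⟨A.injective_ofResidues, A.surjective_ofResidues⟩
    fun x => ⟨?_, ?_⟩
  · rintro ⟨z, hz⟩
    exact ⟨z, A.injective_ofResidues ((A.ofResidues_diag z).trans hz)⟩
  · rintro ⟨z, rfl⟩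
    exact ⟨z, (A.ofResidues_diag z).symm⟩

end Completion

/-! ### Rational primitives of integral cocycles -/

/-- The extension of `B` by `ℤ` that is determined by a cocycle. -/
@[ext]
structure CocycleExtension {B : Type} [AddCommGroup B] (c : cocycles B ℤ) where
  /-- the component in the base -/
  base : B
  /-- the component in the kernel -/
  fiber : ℤ

namespace CocycleExtension

variable {B : Type} [AddCommGroup B] (c : cocycles B ℤ)

instance : Add (CocycleExtension c) :=
  ⟨fun x y => ⟨x.base + y.base, x.fiber + y.fiber + c.1 (x.base, y.base)⟩⟩

instance : Zero (CocycleExtension c) := ⟨⟨0, 0⟩⟩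

instance : Neg (CocycleExtension c) :=
  ⟨fun x => ⟨-x.base, -x.fiber - c.1 (-x.base, x.base)⟩⟩

instance : AddCommGroup (CocycleExtension c) where
  add_assoc x y z := by
    ext
    · exact add_assoc _ _ _
    · have := c.2.2.1 x.base y.base z.base
      show x.fiber + y.fiber + c.1 (x.base, y.base) + z.fiber + c.1 (x.base + y.base, z.base) =
        x.fiber + (y.fiber + z.fiber + c.1 (y.base, z.base)) + c.1 (x.base, y.base + z.base)
      linarith
  zero_add x := by
    ext
    · exact zero_add _
    · show 0 + x.fiber + c.1 (0, x.base) = x.fiber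
      rw [(c.2.1 _).2, add_zero, zero_add]
  add_zero x := by
    ext
    · exact add_zero _
    · show x.fiber + 0 + c.1 (x.base, 0) = x.fiber
      rw [(c.2.1 _).1, add_zero, add_zero]
  neg_add_cancel x := by
    ext
    · exact neg_add_cancel _
    · show -x.fiber - c.1 (-x.base, x.base) + x.fiber + c.1 (-x.base, x.base) = 0
      ring
  add_comm x y := by
    ext
    · exact add_comm _ _
    · show x.fiber + y.fiber + c.1 (x.base, y.base) = y.fiber + x.fiber + c.1 (y.base, x.base)
      rw [c.2.2.2 x.base, add_comm x.fiber]
  nsmul := nsmulRec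
  zsmul := zsmulRec

/-- The inclusion of the kernel. -/
def incl : ℤ →+ CocycleExtension c where
  toFun k := ⟨0, k⟩
  map_zero' := rfl
  map_add' k l := by
    ext
    · exact (add_zero 0).symm
    · show k + l = k + l + c.1 (0, 0)
      rw [(c.2.1 0).1, add_zero]

theorem incl_injective : Function.Injective (incl c) := fun _ _ h =>
  congrArg CocycleExtension.fiber h

end CocycleExtension

/-- Every integral cocycle is a coboundary over the rationals. -/
theorem exists_rat_primitive {B : Type} [AddCommGroup B] (c : cocycles B ℤ) :
    ∃ h : B → ℚ, ∀ x y, (c.1 (x, y) : ℚ) = h x + h y - h (x + y) := by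
  -- `ℚ` is injective, so `ℤ → ℚ` extends to the whole extension. Evaluating on the section `x ↦ (x,
  -- 0)`, whose failure to be additive is `c`, gives the primitive.
  obtain ⟨g, hg⟩ := (Module.Baer.of_divisible ℚ).extension_property_addMonoidHom
    (CocycleExtension.incl c) (CocycleExtension.incl_injective c) (Int.castAddHom ℚ)
  refine ⟨fun x => g ⟨x, 0⟩, fun x y => ?_⟩
  have h1 : (⟨x, 0⟩ + ⟨y, 0⟩ : CocycleExtension c) =
      ⟨x + y, 0⟩ + CocycleExtension.incl c (c.1 (x, y)) := by
    ext
    · exact (add_zero _).symm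
    · show (0 : ℤ) + 0 + c.1 (x, y) = 0 + c.1 (x, y) + c.1 (x + y, 0)
      rw [(c.2.1 _).1]
      ring
  have h2 := congrArg g h1
  rw [map_add, map_add] at h2
  have h3 : g (CocycleExtension.incl c (c.1 (x, y))) = (c.1 (x, y) : ℚ) :=
    DFunLike.congr_fun hg (c.1 (x, y))
  rw [h2, h3]
  ring

theorem primitive_zero {B : Type} [AddCommGroup B] {c : cocycles B ℤ} {h : B → ℚ}
    (hh : ∀ x y, (c.1 (x, y) : ℚ) = h x + h y - h (x + y)) : h 0 = 0 := by
  have := hh 0 0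
  rw [(c.2.1 0).1] at this
  simpa using this.symm

/-- The sum telescopes, since `c(x, kx) = h(x) + h(kx) - h((k+1)x)`. -/
theorem sum_cocycle_multiples {B : Type} [AddCommGroup B] {c : cocycles B ℤ} {h : B → ℚ}
    (hh : ∀ x y, (c.1 (x, y) : ℚ) = h x + h y - h (x + y)) (x : B) (n : ℕ) :
    ((∑ k ∈ Finset.range n, c.1 (x, k • x) : ℤ) : ℚ) = n * h x - h (n • x) := by
  induction n with
  | zero => simp [primitive_zero hh]
  | succ n ih =>
    rw [Finset.sum_range_succ, Int.cast_add, ih, hh, succ_nsmul']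
    push_cast
    ring

/-! ### The `Ext` group and the model -/

section ExtModel

variable (d : ℕ) (m : Nat.Primes → ℕ+)

variable {d} in
/-- The element `eᵢ / p^{m_p}` of `ℤ[1/𝒫ᵐ]ᵈ`. -/
def primeGenerator (p : Nat.Primes) (i : Fin d) : invPrimesPow d m :=
  ⟨Pi.single i (1 / (p : ℚ) ^ (m p : ℕ)), fun j _ => by
    rcases eq_or_ne j i with rfl | hj
    · rw [Pi.single_eq_same]
      exact one_div_mem_invPrimes m p
    · rw [Pi.single_eq_of_ne hj]
      exact (invPrimes m).zero_mem⟩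

variable {d} in
/-- The unit vector `eᵢ` as an element of `ℤ[1/𝒫ᵐ]ᵈ`. -/
def unitVector (i : Fin d) : invPrimesPow d m :=
  ⟨Pi.single i 1, intLattice_le_invPrimesPow d m fun j _ => by
    rcases eq_or_ne j i with rfl | hj
    · exact ⟨1, by simp⟩
    · exact ⟨0, by simp [hj]⟩⟩

variable {d} in
theorem sum_mul_unitVector (r : Fin d → ℚ) (i : Fin d) :
    ∑ j, r j * (unitVector m i).1 j = r i := by
  have h : (unitVector m i).1 = Pi.single i 1 := rfl
  simp [h, Pi.single_apply]

variable {d} in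
theorem sum_mul_primeGenerator (r : Fin d → ℚ) (p : Nat.Primes) (i : Fin d) :
    ∑ j, r j * (primeGenerator m p i).1 j = r i * (1 / (p : ℚ) ^ (m p : ℕ)) := by
  have h : (primeGenerator m p i).1 = Pi.single i (1 / (p : ℚ) ^ (m p : ℕ)) := rfl
  simp [h, Pi.single_apply]

variable {d} in
theorem smul_primeGenerator (p : Nat.Primes) (i : Fin d) :
    ((p : ℕ) ^ (m p : ℕ)) • primeGenerator m p i = unitVector m i := by
  ext1
  show ((p : ℕ) ^ (m p : ℕ)) • (Pi.single i (1 / (p : ℚ) ^ (m p : ℕ)) : Fin d → ℚ) = Pi.single i 1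
  have hp : (p : ℚ) ^ (m p : ℕ) ≠ 0 := pow_ne_zero _ (by exact_mod_cast p.2.ne_zero)
  rw [← Pi.single_smul, nsmul_eq_mul]
  congr 1
  push_cast
  field_simp

/-- Partial fractions: if `ua + vb = 1`, then `1/(ab) = u/b + v/a`. -/
theorem one_div_mem_of_prime_powers {M : AddSubgroup ℚ}
    (hM : ∀ p : Nat.Primes, (1 / (p : ℚ) ^ (m p : ℕ)) ∈ M) (b : ℕ) (hb : 0 < b)
    (h : ∀ (p : Nat.Primes) (k : ℕ), (p : ℕ) ^ k ∣ b → k ≤ m p) : (1 / b : ℚ) ∈ M := by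
  induction b using Nat.recOnPosPrimePosCoprime with
  | zero => exact absurd hb (lt_irrefl _)
  | one =>
    -- The prime `2` is an arbitrary choice; a multiple of any generator gives `1 ∈ M`.
    have h2 := M.nsmul_mem (hM ⟨2, Nat.prime_two⟩) (2 ^ (m ⟨2, Nat.prime_two⟩ : ℕ))
    simpa using h2
  | prime_pow p k hp hk =>
    have hkm := h ⟨p, hp⟩ k dvd_rfl
    have h2 := M.nsmul_mem (hM ⟨p, hp⟩) (p ^ ((m ⟨p, hp⟩ : ℕ) - k))
    have hp0 : (p : ℚ) ≠ 0 := by exact_mod_cast hp.ne_zero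
    convert h2 using 1
    rw [nsmul_eq_mul]
    push_cast
    rw [mul_one_div, div_eq_div_iff (pow_ne_zero _ hp0) (pow_ne_zero _ hp0), one_mul, ← pow_add,
      Nat.sub_add_cancel hkm]
  | coprime a b ha hb' hab iha ihb =>
    have h1 := iha (by omega) fun p k hk => h p k (hk.mul_right _)
    have h2 := ihb (by omega) fun p k hk => h p k (hk.mul_left _)
    obtain ⟨u, v, huv⟩ := (Nat.isCoprime_iff_coprime.2 hab)
    have ha0 : (a : ℚ) ≠ 0 := by positivity
    have hb0 : (b : ℚ) ≠ 0 := by positivity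
    have huv' : (u : ℚ) * a + v * b = 1 := by exact_mod_cast huv
    have h3 := M.add_mem (M.zsmul_mem h2 u) (M.zsmul_mem h1 v)
    convert h3 using 1
    rw [zsmul_eq_mul, zsmul_eq_mul]
    push_cast
    field_simp
    linarith

theorem invPrimes_le_of_prime_powers {M : AddSubgroup ℚ}
    (hM : ∀ p : Nat.Primes, (1 / (p : ℚ) ^ (m p : ℕ)) ∈ M) : invPrimes m ≤ M := by
  rintro _ ⟨a, b, hb, h, rfl⟩
  have := M.zsmul_mem (one_div_mem_of_prime_powers m hM b hb h) a
  rwa [zsmul_eq_mul, mul_one_div] at this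

variable {d} in
theorem invPrimesPow_le_of_primeGenerator {M : AddSubgroup (Fin d → ℚ)}
    (hM : ∀ p (i : Fin d), (primeGenerator m p i).1 ∈ M) : invPrimesPow d m ≤ M := by
  intro x hx
  have h : ∀ i, (Pi.single i (x i) : Fin d → ℚ) ∈ M := fun i =>
    invPrimes_le_of_prime_powers m
      (M := M.comap (AddMonoidHom.single (fun _ : Fin d => ℚ) i)) (fun p => hM p i)
      (hx i (Set.mem_univ i))
  rw [← Finset.univ_sum_single x]
  exact M.sum_mem fun i _ => h i

/-- The homomorphism that measures the failure of a primitive to be integral. -/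
def cocycleResidues : cocycles (invPrimesPow d m) ℤ →+ Residues d m where
  toFun c p i := ((∑ k ∈ Finset.range ((p : ℕ) ^ (m p : ℕ)),
    c.1 (primeGenerator m p i, k • primeGenerator m p i) : ℤ) : ZMod _)
  map_zero' := by
    funext p
    ext i
    simp
  map_add' a b := by
    funext p
    ext i
    simp [Finset.sum_add_distrib]

theorem continuous_cocycleResidues : Continuous (cocycleResidues d m) := by
  refine continuous_pi fun p => continuous_pi fun i => ?_
  have h : Continuous fun c : cocycles (invPrimesPow d m) ℤ =>
      ∑ k ∈ Finset.range ((p : ℕ) ^ (m p : ℕ)),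
        c.1 (primeGenerator m p i, k • primeGenerator m p i) :=
    continuous_finsetSum _ fun k _ => (continuous_apply _).comp continuous_subtype_val
  exact (continuous_of_discreteTopology
    (f := fun t : ℤ => (t : ZMod ((p : ℕ) ^ (m p : ℕ))))).comp h

variable {d m}

/-- For an integral primitive the term `p^{m_p} h(g)` vanishes modulo `p^{m_p}`. What remains is
`-h(eᵢ)`, the same integer at each prime. -/
theorem cocycleResidues_mem_range_of_mem_coboundaries {c : cocycles (invPrimesPow d m) ℤ}
    (hc : c ∈ coboundaries (invPrimesPow d m) ℤ) :
    cocycleResidues d m c ∈ (diag d m).range := by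
  obtain ⟨h, hh⟩ := hc
  refine ⟨fun i => -h (unitVector m i), ?_⟩
  funext p
  ext i
  have hh' : ∀ x y, (c.1 (x, y) : ℚ) = h x + h y - h (x + y) := fun x y => by
    rw [hh x y]
    push_cast
    rfl
  have h1 := sum_cocycle_multiples (h := fun x => (h x : ℚ)) hh' (primeGenerator m p i)
    ((p : ℕ) ^ (m p : ℕ))
  rw [smul_primeGenerator] at h1
  have h2 : ∑ k ∈ Finset.range ((p : ℕ) ^ (m p : ℕ)),
      c.1 (primeGenerator m p i, k • primeGenerator m p i) =
      (((p : ℕ) ^ (m p : ℕ) : ℕ) : ℤ) * h (primeGenerator m p i) - h (unitVector m i) := by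
    exact_mod_cast h1
  show ((-h (unitVector m i) : ℤ) : ZMod ((p : ℕ) ^ (m p : ℕ))) =
    ((∑ k ∈ Finset.range ((p : ℕ) ^ (m p : ℕ)),
      c.1 (primeGenerator m p i, k • primeGenerator m p i) : ℤ) : ZMod _)
  rw [h2, Int.cast_sub, Int.cast_mul, Int.cast_natCast, ZMod.natCast_self, zero_mul, zero_sub,
    Int.cast_neg]

theorem mem_coboundaries_of_cocycleResidues_mem_range {c : cocycles (invPrimesPow d m) ℤ}
    (hc : cocycleResidues d m c ∈ (diag d m).range) :
    c ∈ coboundaries (invPrimesPow d m) ℤ := by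
  obtain ⟨z, hz⟩ := hc
  obtain ⟨h₀, hh₀⟩ := exists_rat_primitive c
  -- Adding a linear function does not change the coboundary. This one normalizes `h(eᵢ)` to `-zᵢ`,
  -- and the congruences then make `h` integral at every `eᵢ/p^{m_p}`.
  let r : Fin d → ℚ := fun i => -z i - h₀ (unitVector m i)
  let h : invPrimesPow d m → ℚ := fun x => h₀ x + ∑ i, r i * x.1 i
  have hh : ∀ x y, (c.1 (x, y) : ℚ) = h x + h y - h (x + y) := by
    intro x y
    rw [hh₀]
    simp only [h, AddSubgroup.coe_add, Pi.add_apply, mul_add, Finset.sum_add_distrib]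
    ring
  have hunit : ∀ i, h (unitVector m i) = -z i := by
    intro i
    simp only [h, sum_mul_unitVector, r]
    ring
  have hgen : ∀ p i, ∃ k : ℤ, h (primeGenerator m p i) = k := by
    intro p i
    have h1 := sum_cocycle_multiples hh (primeGenerator m p i) ((p : ℕ) ^ (m p : ℕ))
    rw [smul_primeGenerator, hunit] at h1
    have h2 : ((z i : ℤ) : ZMod ((p : ℕ) ^ (m p : ℕ))) =
      ((∑ k ∈ Finset.range ((p : ℕ) ^ (m p : ℕ)),
        c.1 (primeGenerator m p i, k • primeGenerator m p i) : ℤ) : ZMod _) :=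
      congrFun (congrFun hz p) i
    rw [← sub_eq_zero, ← Int.cast_sub, ZMod.intCast_zmod_eq_zero_iff_dvd] at h2
    obtain ⟨k, hk⟩ := h2
    refine ⟨-k, ?_⟩
    have hp : (((p : ℕ) ^ (m p : ℕ) : ℕ) : ℚ) ≠ 0 := by
      exact_mod_cast pow_ne_zero _ p.2.ne_zero
    have hk' := congrArg (Int.cast : ℤ → ℚ) hk
    rw [Int.cast_sub, h1, Int.cast_mul, Int.cast_natCast] at hk'
    apply mul_left_cancel₀ hp
    push_cast at hk' ⊢
    linarith
  -- Since `c` is integral, the points where `h` is an integer form a subgroup, so integrality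
  -- passes from the generators to everything.
  let M : AddSubgroup (Fin d → ℚ) :=
    { carrier := {x | ∃ hx : x ∈ invPrimesPow d m, ∃ k : ℤ, h ⟨x, hx⟩ = k}
      zero_mem' := ⟨AddSubgroup.zero_mem _, 0, by
        rw [Int.cast_zero]
        exact primitive_zero hh⟩
      add_mem' := by
        rintro a b ⟨ha, k, hk⟩ ⟨hb, l, hl⟩
        refine ⟨AddSubgroup.add_mem _ ha hb, k + l - c.1 (⟨a, ha⟩, ⟨b, hb⟩), ?_⟩
        have := hh ⟨a, ha⟩ ⟨b, hb⟩
        rw [AddMemClass.mk_add_mk] at this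
        push_cast
        linarith
      neg_mem' := by
        rintro a ⟨ha, k, hk⟩
        refine ⟨AddSubgroup.neg_mem _ ha, c.1 (⟨a, ha⟩, -⟨a, ha⟩) - k, ?_⟩
        have := hh ⟨a, ha⟩ (-⟨a, ha⟩)
        rw [add_neg_cancel, primitive_zero hh] at this
        change h (-⟨a, ha⟩) = _
        push_cast
        linarith }
  have hM : invPrimesPow d m ≤ M := invPrimesPow_le_of_primeGenerator m fun p i =>
    ⟨(primeGenerator m p i).2, hgen p i⟩
  have hint : ∀ x : invPrimesPow d m, ∃ k : ℤ, h x = k := fun x => (hM x.2).2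
  choose k hk using hint
  refine ⟨k, fun x y => ?_⟩
  have := hh x y
  rw [hk, hk, hk] at this
  exact_mod_cast this

/-- A bound on the primes that matter for the pairing with `x`. -/
noncomputable def pairingBound (x : invPrimesPow d m) : ℕ :=
  (exists_bound_pairing_mem_int x.2).choose

/-- The representative in `[0, 1)` of the value at `x` of the character of `ℤ[1/𝒫ᵐ]ᵈ / ℤᵈ` that
is given by `k`. -/
noncomputable def character (k : Residues d m) (x : invPrimesPow d m) : ℚ :=
  Int.fract (∑ i, (approx (pairingBound x) k i : ℚ) * x.1 i)

/-- Beyond the bound for `x`, two approximations differ by a vector that pairs integrally with `x`.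
Several points can thus be treated at one common level, where the pairing is linear. -/
theorem character_eq (k : Residues d m) (x : invPrimesPow d m) {n : ℕ} (hn : pairingBound x ≤ n) :
    character k x = Int.fract (∑ i, (approx n k i : ℚ) * x.1 i) := by
  obtain ⟨t, ht⟩ := (exists_bound_pairing_mem_int x.2).choose_spec
    (approx (pairingBound x) k - approx n k) fun p hp i => by
      have hp' : (p : ℕ) < pairingBound x := mem_primesLT.1 hp
      rw [Pi.sub_apply, Int.cast_sub, approx_cast _ _ hp', approx_cast _ _ (hp'.trans_le hn),
        sub_self]
  rw [character, Int.fract_eq_fract]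
  refine ⟨t, ?_⟩
  rw [← ht, ← Finset.sum_sub_distrib]
  refine Finset.sum_congr rfl fun i _ => ?_
  rw [Pi.sub_apply]
  push_cast
  ring

theorem exists_character_add (k : Residues d m) (x y : invPrimesPow d m) :
    ∃ t : ℤ, character k x + character k y - character k (x + y) = t := by
  let n := max (pairingBound x) (max (pairingBound y) (pairingBound (x + y)))
  rw [character_eq k x (n := n) (le_max_left _ _),
    character_eq k y (n := n) ((le_max_left _ _).trans (le_max_right _ _)),
    character_eq k (x + y) (n := n) ((le_max_right _ _).trans (le_max_right _ _))]
  have h : ∑ i, (approx n k i : ℚ) * (x + y).1 i =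
      ∑ i, (approx n k i : ℚ) * x.1 i + ∑ i, (approx n k i : ℚ) * y.1 i := by
    rw [← Finset.sum_add_distrib]
    exact Finset.sum_congr rfl fun i _ => mul_add _ _ _
  rw [h]
  generalize ∑ i, (approx n k i : ℚ) * x.1 i = a
  generalize ∑ i, (approx n k i : ℚ) * y.1 i = b
  refine ⟨⌊a + b⌋ - ⌊a⌋ - ⌊b⌋, ?_⟩
  simp only [Int.fract]
  push_cast
  ring

theorem character_unitVector (k : Residues d m) (i : Fin d) :
    character k (unitVector m i) = 0 := by
  rw [character, Int.fract_eq_zero_iff]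
  exact ⟨approx (pairingBound (unitVector m i)) k i, (sum_mul_unitVector m
    (fun j => (approx (pairingBound (unitVector m i)) k j : ℚ)) i).symm⟩

theorem character_zero (k : Residues d m) : character k 0 = 0 := by
  simp [character]

/-- The coboundary of a character, which is an integral cocycle. -/
noncomputable def characterCocycle (k : Residues d m) : cocycles (invPrimesPow d m) ℤ :=
  ⟨fun p => ⌊character k p.1 + character k p.2 - character k (p.1 + p.2)⌋, by
    -- The floor only serves to land in `ℤ`: its argument is already an integer.
    have h : ∀ x y, (⌊character k x + character k y - character k (x + y)⌋ : ℚ) =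
        character k x + character k y - character k (x + y) := by
      intro x y
      obtain ⟨t, ht⟩ := exists_character_add k x y
      rw [ht, Int.floor_intCast]
    refine ⟨fun x => ?_, fun x y z => ?_, fun x y => ?_⟩
    · simp [character_zero]
    · have : ∀ a b : ℤ, (a : ℚ) = b → a = b := fun a b h => by exact_mod_cast h
      apply this
      push_cast
      rw [h, h, h, h, add_assoc x y z]
      ring
    · dsimp only
      rw [add_comm y x, add_comm (character k y)]⟩

theorem characterCocycle_apply (k : Residues d m) (x y : invPrimesPow d m) :
    ((characterCocycle k).1 (x, y) : ℚ) =
      character k x + character k y - character k (x + y) := by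
  obtain ⟨t, ht⟩ := exists_character_add k x y
  rw [ht]
  show ((⌊character k x + character k y - character k (x + y)⌋ : ℤ) : ℚ) = t
  rw [ht, Int.floor_intCast]

theorem isLocallyConstant_character (x : invPrimesPow d m) :
    IsLocallyConstant fun k : Residues d m => character k x :=
  ((IsLocallyConstant.iff_continuous _).2 (continuous_approx (pairingBound x))).comp
    fun z : Fin d → ℤ => Int.fract (∑ i, (z i : ℚ) * x.1 i)

theorem continuous_characterCocycle :
    Continuous (characterCocycle : Residues d m → cocycles (invPrimesPow d m) ℤ) := by
  refine Continuous.subtype_mk (continuous_pi fun q => ?_) _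
  exact ((((isLocallyConstant_character q.1).add (isLocallyConstant_character q.2)).sub
    (isLocallyConstant_character (q.1 + q.2))).comp Int.floor).continuous

/-- With `a` an approximation of `k` at `i`, the telescoped sum is `p^{m_p}` times the fractional
part of `a/p^{m_p}`. This is congruent to `a` modulo `p^{m_p}`, and the character vanishes at `eᵢ`.
-/
theorem cocycleResidues_characterCocycle (k : Residues d m) :
    cocycleResidues d m (characterCocycle k) = k := by
  funext p
  ext i
  show ((∑ j ∈ Finset.range ((p : ℕ) ^ (m p : ℕ)),
    (characterCocycle k).1 (primeGenerator m p i, j • primeGenerator m p i) : ℤ) :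
      ZMod ((p : ℕ) ^ (m p : ℕ))) = k p i
  have h1 := sum_cocycle_multiples (characterCocycle_apply k) (primeGenerator m p i)
    ((p : ℕ) ^ (m p : ℕ))
  rw [smul_primeGenerator, character_unitVector, sub_zero] at h1
  let n := max (pairingBound (primeGenerator m p i)) (p + 1)
  rw [character_eq k _ (n := n) (le_max_left _ _),
    sum_mul_primeGenerator m (fun j => (approx n k j : ℚ)), Int.fract] at h1
  have hp : (p : ℚ) ^ (m p : ℕ) ≠ 0 := pow_ne_zero _ (by exact_mod_cast p.2.ne_zero)
  rw [mul_sub, Nat.cast_pow, mul_one_div, mul_div_cancel₀ _ hp] at h1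
  generalize ⌊(approx n k i : ℚ) / (p : ℚ) ^ (m p : ℕ)⌋ = t at h1
  have h2 : ∑ j ∈ Finset.range ((p : ℕ) ^ (m p : ℕ)),
      (characterCocycle k).1 (primeGenerator m p i, j • primeGenerator m p i) =
      approx n k i - (((p : ℕ) ^ (m p : ℕ) : ℕ) : ℤ) * t := by
    exact_mod_cast h1
  rw [h2, Int.cast_sub, Int.cast_mul, Int.cast_natCast, ZMod.natCast_self, zero_mul, sub_zero]
  exact approx_cast n k (lt_of_lt_of_le (Nat.lt_succ_self _) (le_max_right _ _)) i

variable (d m)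

theorem bidefinablyIsomorphic_extCover_modelCover :
    BidefinablyIsomorphic (extCover (invPrimesPow d m) ℤ) (modelCover d m) :=
  bidefinablyIsomorphic_of_rightInverse (X := extCover (invPrimesPow d m) ℤ)
    (Y := modelCover d m) (cocycleResidues d m)
    (measurable_borel_of_continuous (continuous_cocycleResidues d m))
    (fun _ => ⟨mem_coboundaries_of_cocycleResidues_mem_range,
      cocycleResidues_mem_range_of_mem_coboundaries⟩)
    characterCocycle (measurable_borel_of_continuous continuous_characterCocycle)
    cocycleResidues_characterCocycle

end ExtModel

/-! ### Functoriality of `Ext` and rescaling of `ℤ[1/𝒫ᵐ]ᵈ` -/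

/-- Pulling cocycles back along a homomorphism. -/
def cocyclesComap {B B' : Type} (F : Type) [AddCommGroup B] [AddCommGroup B'] [AddCommGroup F]
    (e : B →+ B') : cocycles B' F →+ cocycles B F where
  toFun c := ⟨fun p => c.1 (e p.1, e p.2), by
    refine ⟨fun x => ?_, fun x y z => ?_, fun x y => c.2.2.2 _ _⟩
    · simp only [map_zero]
      exact c.2.1 _
    · simp only [map_add]
      exact c.2.2.1 _ _ _⟩
  map_zero' := rfl
  map_add' _ _ := rfl

theorem cocyclesComap_mem_coboundaries {B B' F : Type} [AddCommGroup B] [AddCommGroup B']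
    [AddCommGroup F] (e : B →+ B') {c : cocycles B' F} (hc : c ∈ coboundaries B' F) :
    cocyclesComap F e c ∈ coboundaries B F := by
  obtain ⟨h, hh⟩ := hc
  refine ⟨h ∘ e, fun x y => ?_⟩
  rw [Function.comp_apply, Function.comp_apply, Function.comp_apply, map_add]
  exact hh (e x) (e y)

theorem bidefinablyIsomorphic_extCover_of_addEquiv {B B' F : Type} [AddCommGroup B]
    [AddCommGroup B'] [AddCommGroup F] [Countable B] [Countable B'] [Countable F]
    [TopologicalSpace F] [DiscreteTopology F] (e : B ≃+ B') :
    BidefinablyIsomorphic (extCover B' F) (extCover B F) := by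
  have hcomp : ∀ c : cocycles B' F,
      cocyclesComap F e.symm.toAddMonoidHom (cocyclesComap F e.toAddMonoidHom c) = c := by
    intro c
    ext ⟨x, y⟩
    simp [cocyclesComap]
  have hcomp' : ∀ c : cocycles B F,
      cocyclesComap F e.toAddMonoidHom (cocyclesComap F e.symm.toAddMonoidHom c) = c := by
    intro c
    ext ⟨x, y⟩
    simp [cocyclesComap]
  have hcont : Continuous (cocyclesComap F e.toAddMonoidHom) :=
    Continuous.subtype_mk (continuous_pi fun p : B × B =>
      (continuous_apply (A := fun _ : B' × B' => F) (e p.1, e p.2)).comp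
        continuous_subtype_val) _
  refine bidefinablyIsomorphic_of_bijective (X := extCover B' F) (Y := extCover B F)
    (cocyclesComap F e.toAddMonoidHom) hcont
    ⟨Function.LeftInverse.injective hcomp, Function.RightInverse.surjective hcomp'⟩
    fun c => ⟨?_, ?_⟩
  · intro hc
    have := cocyclesComap_mem_coboundaries e.symm.toAddMonoidHom hc
    exact (congrArg (· ∈ coboundaries B' F) (hcomp c)).mp this
  · exact cocyclesComap_mem_coboundaries e.toAddMonoidHom

/-- In terms of valuations, multiplication by a rational merely shifts the bounds. For the converse,
lowest terms make the valuation at a prime dividing the denominator come from the denominator alone.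
-/
theorem mem_invPrimes_iff {m : Nat.Primes → ℕ+} {q : ℚ} :
    q ∈ invPrimes m ↔ q = 0 ∨ ∀ p : Nat.Primes, -(m p : ℤ) ≤ padicValRat p q := by
  constructor
  · rintro ⟨a, b, hb, h, rfl⟩
    by_cases ha : a = 0
    · exact Or.inl (by simp [ha])
    · refine Or.inr fun p => ?_
      rw [padicValRat.div (by exact_mod_cast ha) (by exact_mod_cast hb.ne'), padicValRat.of_int,
        padicValRat.of_nat]
      have := h p _ (pow_padicValNat_dvd (p := p) (n := b))
      omega
  · rintro (rfl | h)
    · exact (invPrimes m).zero_mem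
    · refine ⟨q.num, q.den, q.den_pos, fun p k hk => ?_, (Rat.num_div_den q).symm⟩
      rcases Nat.eq_zero_or_pos k with rfl | hk0
      · exact Nat.zero_le _
      have hpd : (p : ℕ) ∣ q.den := (dvd_pow_self _ hk0.ne').trans hk
      have hpn : ¬ ((p : ℕ) : ℤ) ∣ q.num := fun hn =>
        Nat.not_coprime_of_dvd_of_dvd p.2.one_lt (Int.natCast_dvd.1 hn) hpd q.reduced
      have h1 := h p
      rw [padicValRat_def, padicValInt.eq_zero_of_not_dvd hpn] at h1
      have h2 := (padicValNat_dvd_iff_le (p := p) q.den_nz).1 hk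
      omega

theorem exists_rat_padicValRat_eq (F : Finset Nat.Primes) (e : Nat.Primes → ℤ) :
    ∃ r : ℚ, r ≠ 0 ∧ ∀ p : Nat.Primes, (p ∈ F → padicValRat p r = e p) ∧
      (p ∉ F → padicValRat p r = 0) := by
  classical
  induction F using Finset.induction_on with
  | empty => exact ⟨1, one_ne_zero, fun p => by simp⟩
  | insert a F ha ih =>
    obtain ⟨r, hr0, hr⟩ := ih
    have ha0 : ((a : ℕ) : ℚ) ≠ 0 := by exact_mod_cast a.2.ne_zero
    refine ⟨r * ((a : ℕ) : ℚ) ^ e a, mul_ne_zero hr0 (zpow_ne_zero _ ha0), fun p => ?_⟩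
    rw [padicValRat.mul hr0 (zpow_ne_zero _ ha0), padicValRat.zpow, padicValRat.of_nat]
    by_cases hpa : p = a
    · subst hpa
      rw [(hr p).2 ha, padicValNat_self]
      simp
    · have h0 : padicValNat (p : ℕ) (a : ℕ) = 0 := padicValNat_primes fun h => hpa (Subtype.ext h)
      rw [h0]
      simpa [hpa] using hr p

theorem EqStar.exists_padicValRat {m m' : Nat.Primes → ℕ+} (h : EqStar m m') :
    ∃ r : ℚ, r ≠ 0 ∧ ∀ p : Nat.Primes, padicValRat p r = m p - m' p := by
  have h' : {p | m p ≠ m' p}.Finite := h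
  obtain ⟨r, hr0, hr⟩ := exists_rat_padicValRat_eq h'.toFinset fun p => (m p : ℤ) - m' p
  refine ⟨r, hr0, fun p => ?_⟩
  by_cases hp : m p = m' p
  · rw [(hr p).2 (by simp [hp]), hp, sub_self]
  · exact (hr p).1 (by simp [hp])

theorem mul_mem_invPrimes {m m' : Nat.Primes → ℕ+} {r : ℚ} (hr0 : r ≠ 0)
    (hr : ∀ p : Nat.Primes, padicValRat p r = m p - m' p) {q : ℚ} (hq : q ∈ invPrimes m) :
    r * q ∈ invPrimes m' := by
  rw [mem_invPrimes_iff] at hq ⊢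
  rcases eq_or_ne q 0 with rfl | hq0
  · exact Or.inl (mul_zero r)
  · refine Or.inr fun p => ?_
    have := hq.resolve_left hq0 p
    rw [padicValRat.mul hr0 hq0, hr]
    omega

/-- Finite difference of the exponents is exactly what allows a single rational `r` to have
valuation `m_p - m'_p` everywhere; scaling by `r` is the isomorphism. -/
theorem EqStar.nonempty_addEquiv {m m' : Nat.Primes → ℕ+} (h : EqStar m m') (d : ℕ) :
    Nonempty (invPrimesPow d m ≃+ invPrimesPow d m') := by
  obtain ⟨r, hr0, hr⟩ := h.exists_padicValRat
  refine ⟨{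
    toFun := fun x => ⟨fun i => r * x.1 i, fun i hi => mul_mem_invPrimes hr0 hr (x.2 i hi)⟩
    invFun := fun x => ⟨fun i => r⁻¹ * x.1 i, fun i hi =>
      mul_mem_invPrimes (inv_ne_zero hr0) (fun p => by rw [padicValRat.inv, hr]; ring) (x.2 i hi)⟩
    left_inv := fun x => ?_
    right_inv := fun x => ?_
    map_add' := fun x y => ?_ }⟩
  · ext i
    exact inv_mul_cancel_left₀ hr0 _
  · ext i
    exact mul_inv_cancel_left₀ hr0 _
  · ext i
    exact mul_add _ _ _

theorem definablyIsomorphic_extCover_iff {d : ℕ} (hd : 1 ≤ d) (m m' : Nat.Primes → ℕ+) :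
    DefinablyIsomorphic (extCover (invPrimesPow d m) ℤ) (extCover (invPrimesPow d m') ℤ) ↔
      EqStar m m' := by
  constructor
  · intro h
    exact eqStar_of_definablyIsomorphic_modelCover hd
      (((bidefinablyIsomorphic_extCover_modelCover d m).symm.definablyIsomorphic.trans h).trans
        (bidefinablyIsomorphic_extCover_modelCover d m').definablyIsomorphic)
  · intro h
    obtain ⟨e⟩ := h.nonempty_addEquiv d
    exact (bidefinablyIsomorphic_extCover_of_addEquiv e).symm.definablyIsomorphic

theorem definablyIsomorphic_modelCover_iff {d : ℕ} (hd : 1 ≤ d) (m m' : Nat.Primes → ℕ+) :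
    DefinablyIsomorphic (modelCover d m) (modelCover d m') ↔ EqStar m m' := by
  refine ⟨eqStar_of_definablyIsomorphic_modelCover hd, fun h => ?_⟩
  exact ((bidefinablyIsomorphic_extCover_modelCover d m).symm.definablyIsomorphic.trans
    ((definablyIsomorphic_extCover_iff hd m m').2 h)).trans
      (bidefinablyIsomorphic_extCover_modelCover d m').definablyIsomorphic

theorem Cofiltration.definablyIsomorphic_completionCover_iff {d : ℕ} (hd : 1 ≤ d)
    {m m' : Nat.Primes → ℕ+} (A : Cofiltration (invPrimesPow d m))
    (A' : Cofiltration (invPrimesPow d m')) :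
    DefinablyIsomorphic A.completionCover A'.completionCover ↔ EqStar m m' := by
  rw [← definablyIsomorphic_modelCover_iff hd]
  have h := A.bidefinablyIsomorphic_modelCover
  have h' := A'.bidefinablyIsomorphic_modelCover
  exact ⟨fun k => (h.definablyIsomorphic.trans k).trans h'.symm.definablyIsomorphic,
    fun k => (h.symm.definablyIsomorphic.trans k).trans h'.definablyIsomorphic⟩

/-! ### Continuum many classes -/

/-- A family of exponents indexed by binary sequences in which distinct members differ at almost
all primes. -/
def binaryExponents (x : ℕ → Bool) (p : Nat.Primes) : ℕ+ :=
  (∑ i ∈ Finset.range p, if x i then 2 ^ i else 0).succPNat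

theorem sum_bits_injective (n : ℕ) (x y : ℕ → Bool)
    (h : (∑ i ∈ Finset.range n, if x i then 2 ^ i else 0) =
      ∑ i ∈ Finset.range n, if y i then 2 ^ i else 0) : ∀ i < n, x i = y i := by
  rw [← Finset.sum_filter, ← Finset.sum_filter] at h
  have h1 := congrArg (fun k => (Nat.bitIndices k).toFinset) h
  simp only [Finset.toFinset_bitIndices_sum_two_pow] at h1
  intro i hi
  have h2 := Finset.ext_iff.1 h1 i
  simp only [Finset.mem_filter, Finset.mem_range, hi, true_and] at h2
  exact Bool.eq_iff_iff.2 h2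

/-- The exponent at `p` encodes the first `p` bits. Once `x i ≠ y i`, the exponents differ at every
prime above `i`. -/
theorem not_eqStar_binaryExponents {x y : ℕ → Bool} (hxy : x ≠ y) :
    ¬ EqStar (binaryExponents x) (binaryExponents y) := by
  obtain ⟨i, hi⟩ := Function.ne_iff.1 hxy
  intro h
  have hsub : {p : Nat.Primes | i < p} ⊆
      {p | binaryExponents x p ≠ binaryExponents y p} := fun p hp heq =>
    hi (sum_bits_injective p x y (Nat.succPNat_injective heq) i hp)
  have hfin := h.subset hsub
  obtain ⟨n, hn⟩ := (hfin.image fun p : Nat.Primes => (p : ℕ)).bddAbove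
  obtain ⟨q, hq, hp⟩ := Nat.exists_infinite_primes (max n i + 1)
  have := hn ⟨⟨q, hp⟩, show i < q by omega, rfl⟩
  simp only at this
  omega

theorem exists_continuum_pairwise_not_definablyIsomorphic
    (X : (Nat.Primes → ℕ+) → PolishCover)
    (habs : ∀ m m', AbstractlyIsomorphic (X m) (X m'))
    (hdef : ∀ m m', DefinablyIsomorphic (X m) (X m') ↔ EqStar m m') :
    ∃ S ⊆ Set.range X, Cardinal.mk S = Cardinal.continuum ∧
      S.Pairwise fun Y Z => AbstractlyIsomorphic Y Z ∧ ¬ DefinablyIsomorphic Y Z := by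
  -- Equal covers are definably isomorphic by reflexivity, so the classification also separates the
  -- covers themselves.
  have hinj : Function.Injective fun x => X (binaryExponents x) := by
    intro x y hxy
    by_contra hne
    refine not_eqStar_binaryExponents hne ((hdef _ _).1 ?_)
    simp only at hxy
    rw [hxy]
    exact DefinablyIsomorphic.refl _
  refine ⟨Set.range fun x => X (binaryExponents x), ?_, ?_, ?_⟩
  · rintro _ ⟨x, rfl⟩
    exact ⟨_, rfl⟩
  · have := Cardinal.mk_range_eq_of_injective hinj
    simpa using this
  · rintro _ ⟨x, rfl⟩ _ ⟨y, rfl⟩ hne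
    exact ⟨habs _ _, fun h => not_eqStar_binaryExponents (fun hxy => hne (by rw [hxy]))
      ((hdef _ _).1 h)⟩

/-! ### Prüfer groups -/

theorem mem_padicInt_iff {p : Nat.Primes} {x : ℚ_[(p : ℕ)]} :
    x ∈ (PadicInt.subring (p : ℕ)).toAddSubgroup ↔ ‖x‖ ≤ 1 := Iff.rfl

theorem Prufer.mk_eq_mk_iff {p : Nat.Primes} {x y : ℚ_[(p : ℕ)]} :
    (QuotientAddGroup.mk x : Prufer p) = QuotientAddGroup.mk y ↔ ‖y - x‖ ≤ 1 := by
  rw [QuotientAddGroup.eq, neg_add_eq_sub, mem_padicInt_iff]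

/-- Scale into `ℤ_p` by a power `p^j`, approximate by an integer modulo `p^j`, and divide back; the
error is a `p`-adic integer. -/
theorem Prufer.exists_eq_mk (p : Nat.Primes) (t : Prufer p) :
    ∃ (a : ℤ) (j : ℕ), t = QuotientAddGroup.mk ((a : ℚ_[(p : ℕ)]) / (p : ℚ_[(p : ℕ)]) ^ j) := by
  induction t using QuotientAddGroup.induction_on with
  | H q =>
    have hp0 : ((p : ℕ) : ℚ_[(p : ℕ)]) ≠ 0 := by exact_mod_cast p.2.ne_zero
    have hpn : ‖((p : ℕ) : ℚ_[(p : ℕ)])‖ < 1 := Padic.norm_p_lt_one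
    obtain ⟨j, hj⟩ : ∃ j : ℕ, ‖((p : ℕ) : ℚ_[(p : ℕ)]) ^ j * q‖ ≤ 1 := by
      obtain ⟨j, hj⟩ := exists_pow_lt_of_lt_one (y := ‖((p : ℕ) : ℚ_[(p : ℕ)])‖)
        (show (0 : ℝ) < 1 / (‖q‖ + 1) by positivity) hpn
      refine ⟨j, ?_⟩
      rw [norm_mul, norm_pow]
      calc _ ≤ 1 / (‖q‖ + 1) * (‖q‖ + 1) :=
            mul_le_mul hj.le (by linarith) (norm_nonneg _) (by positivity)
        _ = 1 := by field_simp
    let x : ℤ_[(p : ℕ)] := ⟨((p : ℕ) : ℚ_[(p : ℕ)]) ^ j * q, hj⟩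
    obtain ⟨c, hc⟩ := Ideal.mem_span_singleton.1 (PadicInt.appr_spec j x)
    refine ⟨x.appr j, j, ?_⟩
    rw [Prufer.mk_eq_mk_iff, norm_sub_rev]
    have hc' : ((p : ℕ) : ℚ_[(p : ℕ)]) ^ j * q - (x.appr j : ℕ) =
        ((p : ℕ) : ℚ_[(p : ℕ)]) ^ j * c := by
      have := congrArg (fun t : ℤ_[(p : ℕ)] => (t : ℚ_[(p : ℕ)])) hc
      push_cast at this
      exact this
    have hq : q - ((x.appr j : ℕ) : ℤ) / ((p : ℕ) : ℚ_[(p : ℕ)]) ^ j = c := by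
      have hpj : ((p : ℕ) : ℚ_[(p : ℕ)]) ^ j ≠ 0 := pow_ne_zero _ hp0
      apply mul_left_cancel₀ hpj
      rw [← hc', mul_sub, mul_div_cancel₀ _ hpj, Int.cast_natCast]
    rw [hq]
    exact c.2

instance (p : Nat.Primes) : Countable (Prufer p) := by
  have : Function.Surjective fun t : ℤ × ℕ =>
      (QuotientAddGroup.mk ((t.1 : ℚ_[(p : ℕ)]) / (p : ℚ_[(p : ℕ)]) ^ t.2) : Prufer p) := fun t => by
    obtain ⟨a, j, h⟩ := Prufer.exists_eq_mk p t
    exact ⟨(a, j), h.symm⟩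
  exact this.countable

theorem Prufer.smul_surjective (p : Nat.Primes) {n : ℤ} (hn : n ≠ 0) :
    Function.Surjective fun t : Prufer p => n • t := by
  intro t
  induction t using QuotientAddGroup.induction_on with
  | H q =>
    refine ⟨QuotientAddGroup.mk (q / n), ?_⟩
    have hn' : (n : ℚ_[(p : ℕ)]) ≠ 0 := by exact_mod_cast hn
    show (QuotientAddGroup.mk (n • (q / n)) : Prufer p) = QuotientAddGroup.mk q
    rw [zsmul_eq_mul, mul_div_cancel₀ _ hn']

/-- The direct sum of all Prüfer groups. -/
abbrev PruferSum : Type := DirectSum Nat.Primes fun p => Prufer p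

theorem PruferSum.smul_surjective {n : ℤ} (hn : n ≠ 0) :
    Function.Surjective fun t : PruferSum => n • t := by
  classical
  intro t
  induction t using DirectSum.induction_on with
  | zero => exact ⟨0, smul_zero n⟩
  | of p t =>
    obtain ⟨s, hs⟩ := Prufer.smul_surjective p hn t
    refine ⟨DirectSum.of _ p s, ?_⟩
    show n • DirectSum.of _ p s = _
    rw [← map_zsmul]
    exact congrArg _ hs
  | add a b ha hb =>
    obtain ⟨a', rfl⟩ := ha
    obtain ⟨b', rfl⟩ := hb
    exact ⟨a' + b', smul_add _ _ _⟩

/-- Divisibility makes this group injective, which is what lets it split off in `exists_splitting`.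
-/
noncomputable instance : DivisibleBy PruferSum ℤ :=
  divisibleByOfSMulRightSurj _ _ fun hn => PruferSum.smul_surjective hn

/-! ### The torsion of `∏ₚ ℤ/p^{m_p}` modulo `ℤ` -/

section Torsion

variable (m : Nat.Primes → ℕ+)

/-- The ring `∏ₚ ℤ/p^{m_p}`. -/
abbrev ScalarResidues : Type := (p : Nat.Primes) → ZMod ((p : ℕ) ^ (m p : ℕ))

/-- The pairs of a residue family and a rational with a common integral multiple. -/
def commensurable : AddSubgroup (ScalarResidues m × ℚ) where
  carrier := {x | ∃ n : ℕ, n ≠ 0 ∧ ∃ k : ℤ, (n : ScalarResidues m) * x.1 = k ∧ n * x.2 = k}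
  zero_mem' := ⟨1, one_ne_zero, 0, by simp⟩
  add_mem' := by
    rintro x y ⟨n, hn, k, h1, h2⟩ ⟨n', hn', k', h1', h2'⟩
    refine ⟨n * n', mul_ne_zero hn hn', n' * k + n * k', ?_, ?_⟩
    · rw [Prod.fst_add]
      push_cast
      linear_combination (n' : ScalarResidues m) * h1 + (n : ScalarResidues m) * h1'
    · rw [Prod.snd_add]
      push_cast
      linear_combination (n' : ℚ) * h2 + (n : ℚ) * h2'
  neg_mem' := by
    rintro x ⟨n, hn, k, h1, h2⟩
    refine ⟨n, hn, -k, ?_, ?_⟩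
    · rw [Prod.fst_neg, mul_neg, h1, Int.cast_neg]
    · rw [Prod.snd_neg, mul_neg, h2, Int.cast_neg]

variable {m}

theorem int_eq_zero_of_cast_eq_zero {z : ℤ} (h : (z : ScalarResidues m) = 0) : z = 0 :=
  int_eq_zero_of_forall_dvd 0 fun q _ =>
    (intCast_residue_eq_zero_iff m q z).1 (congrFun h q)

/-- The rational partner of a residue family is unique, because `ℤ` embeds in the product. So the
commensurable pairs embed in the ring of residues by their first coordinate. -/
theorem commensurable_snd_eq_zero {x : ScalarResidues m × ℚ} (hx : x ∈ commensurable m)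
    (h0 : x.1 = 0) : x.2 = 0 := by
  obtain ⟨n, hn, k, h1, h2⟩ := hx
  rw [h0, mul_zero] at h1
  rw [int_eq_zero_of_cast_eq_zero h1.symm, Int.cast_zero] at h2
  exact (mul_eq_zero.1 h2).resolve_left (by exact_mod_cast hn)

/-- The `p`-component of the Prüfer element that belongs to a commensurable pair. -/
noncomputable def pruferComponent (p : Nat.Primes) (x : ScalarResidues m × ℚ) : Prufer p :=
  QuotientAddGroup.mk (((x.2 : ℚ_[(p : ℕ)]) - ((x.1 p).val : ℤ)) / (p : ℚ_[(p : ℕ)]) ^ (m p : ℕ))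

theorem norm_int_div_le_one_iff (p : Nat.Primes) (a : ℤ) (n : ℕ) :
    ‖(a : ℚ_[(p : ℕ)]) / (p : ℚ_[(p : ℕ)]) ^ n‖ ≤ 1 ↔ ((p : ℕ) : ℤ) ^ n ∣ a := by
  have hp : (0 : ℝ) < (p : ℕ) := by exact_mod_cast p.2.pos
  rw [← Padic.norm_int_le_pow_iff_dvd, norm_div, norm_pow, Padic.norm_p,
    div_le_one (by positivity), inv_pow, zpow_neg, zpow_natCast]

/-- Two lifts of the residue differ by a multiple of `p^{m_p}`, which is integral after the
division. Additivity follows by choosing the sum of the lifts. -/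
theorem pruferComponent_eq (p : Nat.Primes) (x : ScalarResidues m × ℚ) {a : ℤ}
    (ha : (a : ZMod ((p : ℕ) ^ (m p : ℕ))) = x.1 p) : pruferComponent p x =
      QuotientAddGroup.mk (((x.2 : ℚ_[(p : ℕ)]) - a) / (p : ℚ_[(p : ℕ)]) ^ (m p : ℕ)) := by
  rw [pruferComponent, Prufer.mk_eq_mk_iff, ← sub_div, sub_sub_sub_cancel_left, ← Int.cast_sub,
    norm_int_div_le_one_iff, ← intCast_residue_eq_zero_iff, Int.cast_sub, Int.cast_natCast,
    ZMod.natCast_val, ZMod.cast_id, ha]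
  exact sub_self _

theorem pruferComponent_add (p : Nat.Primes) (x y : ScalarResidues m × ℚ) :
    pruferComponent p (x + y) = pruferComponent p x + pruferComponent p y := by
  rw [pruferComponent_eq p (x + y) (a := (x.1 p).val + (y.1 p).val) (by simp),
    pruferComponent, pruferComponent, ← QuotientAddGroup.mk_add]
  congr 1
  rw [Prod.snd_add]
  push_cast
  ring

/-- Here `n` is a `p`-adic unit, and `n` times the numerator is an integer divisible by `p^{m_p}`.
Hence a commensurable pair has only finitely many nonzero components. -/
theorem pruferComponent_eq_zero_of_not_dvd {p : Nat.Primes} {x : ScalarResidues m × ℚ} {n : ℕ}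
    {k : ℤ} (h1 : (n : ScalarResidues m) * x.1 = k) (h2 : n * x.2 = k) (hp : ¬ (p : ℕ) ∣ n) :
    pruferComponent p x = 0 := by
  have hn1 : ‖(n : ℚ_[(p : ℕ)])‖ = 1 :=
    Padic.norm_natCast_eq_one_iff.2 ((Nat.Prime.coprime_iff_not_dvd p.2).2 hp)
  rw [← QuotientAddGroup.mk_zero, pruferComponent, eq_comm, Prufer.mk_eq_mk_iff, sub_zero]
  have h3 : ((n * (x.1 p).val - k : ℤ) : ZMod ((p : ℕ) ^ (m p : ℕ))) = 0 := by
    have := congrFun h1 p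
    push_cast
    rw [ZMod.natCast_val, ZMod.cast_id]
    exact sub_eq_zero.2 this
  rw [intCast_residue_eq_zero_iff, ← norm_int_div_le_one_iff] at h3
  have h2' : (n : ℚ_[(p : ℕ)]) * x.2 = k := by exact_mod_cast congrArg (Rat.cast (K := ℚ_[(p : ℕ)])) h2
  rw [← norm_neg, ← one_mul ‖_‖, ← hn1, ← norm_mul]
  convert h3 using 2
  push_cast
  rw [← h2']
  ring

theorem exists_pruferSum (r : commensurable m) :
    ∃ u : PruferSum, ∀ p, u p = pruferComponent p r.1 := by
  classical
  obtain ⟨x, n, hn, k, h1, h2⟩ := r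
  refine ⟨DFinsupp.mk (primesLT (n + 1)) fun p => pruferComponent p.1 x, fun p => ?_⟩
  refine DFinsupp.mk_apply.trans ?_
  split_ifs with hp
  · rfl
  · refine (pruferComponent_eq_zero_of_not_dvd h1 h2 fun hd => hp (mem_primesLT.2 ?_)).symm
    exact Nat.lt_succ_of_le (Nat.le_of_dvd (Nat.pos_of_ne_zero hn) hd)

/-- The homomorphism to the sum of the Prüfer groups on commensurable pairs. -/
noncomputable def toPruferSum : commensurable m →+ PruferSum :=
  AddMonoidHom.mk' (fun r => (exists_pruferSum r).choose) fun r s => by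
    refine DFinsupp.ext fun p => ?_
    show _ = (exists_pruferSum r).choose p + (exists_pruferSum s).choose p
    rw [(exists_pruferSum r).choose_spec, (exists_pruferSum s).choose_spec]
    exact ((exists_pruferSum (r + s)).choose_spec p).trans (pruferComponent_add p r.1 s.1)

theorem toPruferSum_apply (r : commensurable m) (p : Nat.Primes) :
    toPruferSum r p = pruferComponent p r.1 := (exists_pruferSum r).choose_spec p

theorem rat_eq_int_of_forall_norm_le_one {y : ℚ}
    (h : ∀ p : Nat.Primes, ‖(y : ℚ_[(p : ℕ)])‖ ≤ 1) : ∃ k : ℤ, y = k := by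
  suffices hd : y.den = 1 from ⟨y.num, ((Rat.den_eq_one_iff y).1 hd).symm⟩
  by_contra hd
  obtain ⟨P, hpd⟩ : ∃ P : Nat.Primes, (P : ℕ) ∣ y.den := by
    obtain ⟨p, hp, hpd⟩ := Nat.exists_prime_and_dvd hd
    exact ⟨⟨p, hp⟩, hpd⟩
  have h1 : ‖((y.den : ℤ) : ℚ_[(P : ℕ)])‖ ≤ ((P : ℕ) : ℝ) ^ (-(1 : ℕ) : ℤ) := by
    rw [Padic.norm_int_le_pow_iff_dvd, pow_one]
    exact_mod_cast hpd
  have h2 : (y.num : ℚ_[(P : ℕ)]) = y * ((y.den : ℤ) : ℚ_[(P : ℕ)]) := by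
    have := Rat.mul_den_eq_num y
    exact_mod_cast congrArg (Rat.cast (K := ℚ_[(P : ℕ)])) this.symm
  have h3 : ‖(y.num : ℚ_[(P : ℕ)])‖ ≤ ((P : ℕ) : ℝ) ^ (-(1 : ℕ) : ℤ) := by
    rw [h2, norm_mul]
    exact (mul_le_of_le_one_left (norm_nonneg _) (h P)).trans h1
  rw [Padic.norm_int_le_pow_iff_dvd, pow_one] at h3
  exact Nat.not_coprime_of_dvd_of_dvd P.2.one_lt (Int.natCast_dvd.1 h3) hpd y.reduced

/-- Vanishing at `p` says that the rational is `p`-integral and congruent to the residue modulo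
`p^{m_p}`. At all primes together this makes it an integer that represents the whole family. -/
theorem toPruferSum_eq_zero_iff (r : commensurable m) :
    toPruferSum r = 0 ↔ ∃ k : ℤ, r.1.1 = k ∧ r.1.2 = k := by
  constructor
  · intro h
    have hc : ∀ p : Nat.Primes, ‖((r.1.2 : ℚ_[(p : ℕ)]) - ((r.1.1 p).val : ℤ)) /
        (p : ℚ_[(p : ℕ)]) ^ (m p : ℕ)‖ ≤ 1 := fun p => by
      have hp := toPruferSum_apply r p
      rw [h] at hp
      exact (QuotientAddGroup.eq_zero_iff _).1 hp.symm
    have hint : ∀ p : Nat.Primes, ‖(r.1.2 : ℚ_[(p : ℕ)])‖ ≤ 1 := fun p => by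
      have hp0 : ((p : ℕ) : ℚ_[(p : ℕ)]) ^ (m p : ℕ) ≠ 0 :=
        pow_ne_zero _ (by exact_mod_cast p.2.ne_zero)
      have h1 := (PadicInt.subring (p : ℕ)).mul_mem (hc p)
        ((PadicInt.subring (p : ℕ)).pow_mem (Padic.norm_p_lt_one (p := (p : ℕ))).le (m p : ℕ))
      rw [div_mul_cancel₀ _ hp0] at h1
      have h2 := (PadicInt.subring (p : ℕ)).add_mem h1
        (Padic.norm_int_le_one ((r.1.1 p).val : ℤ))
      rwa [sub_add_cancel] at h2
    obtain ⟨k, hk⟩ := rat_eq_int_of_forall_norm_le_one hint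
    refine ⟨k, ?_, hk⟩
    funext p
    have h1 := hc p
    rw [hk, Rat.cast_intCast, ← Int.cast_sub, norm_int_div_le_one_iff,
      ← intCast_residue_eq_zero_iff, Int.cast_sub, Int.cast_natCast, ZMod.natCast_val,
      ZMod.cast_id, sub_eq_zero] at h1
    exact h1.symm
  · rintro ⟨k, h1, h2⟩
    refine DFinsupp.ext fun p => ?_
    rw [toPruferSum_apply, pruferComponent_eq p r.1 (a := k) (congrFun h1 p).symm, h2,
      Rat.cast_intCast, sub_self, zero_div]
    rfl

theorem surjective_toPruferSum : Function.Surjective (toPruferSum (m := m)) := by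
  classical
  intro t
  induction t using DirectSum.induction_on with
  | zero => exact ⟨0, map_zero _⟩
  | add a b ha hb =>
    obtain ⟨a', rfl⟩ := ha
    obtain ⟨b', rfl⟩ := hb
    exact ⟨a' + b', map_add _ _ _⟩
  | of p t =>
    obtain ⟨a, j, rfl⟩ := Prufer.exists_eq_mk p t
    -- The rational `y = p^{m_p} a / p^j`, read in `ℤ/q^{m_q}` for `q ≠ p` and replaced by `0` at
    -- `p`. Its component at `p` is `a/p^j`; the others vanish because `p^j` serves as common
    -- multiplier.
    let x : ScalarResidues m := fun q => if q = p then 0 else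
      ((p : ℕ) : ZMod ((q : ℕ) ^ (m q : ℕ))) ^ (m p : ℕ) * (a : ZMod ((q : ℕ) ^ (m q : ℕ))) *
        (((p : ℕ) : ZMod ((q : ℕ) ^ (m q : ℕ))) ^ j)⁻¹
    let y : ℚ := (p : ℕ) ^ (m p : ℕ) * a / (p : ℕ) ^ j
    have hpj : ((p : ℕ) : ℚ) ^ j ≠ 0 := pow_ne_zero _ (by exact_mod_cast p.2.ne_zero)
    have h1 : (((p : ℕ) ^ j : ℕ) : ScalarResidues m) * x =
        (((p : ℕ) : ℤ) ^ (m p : ℕ) * a : ℤ) := by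
      funext q
      show (((p : ℕ) ^ j : ℕ) : ZMod _) * x q = ((((p : ℕ) : ℤ) ^ (m p : ℕ) * a : ℤ) : ZMod _)
      by_cases hq : q = p
      · subst hq
        have h0 : (((q : ℕ) ^ (m q : ℕ) : ℕ) : ZMod ((q : ℕ) ^ (m q : ℕ))) = 0 :=
          ZMod.natCast_self _
        push_cast at h0 ⊢
        simp [x, h0]
      · have hu := ZMod.mul_inv_of_unit _ ((isUnit_natCast_residue m hq).pow j)
        simp only [x, if_neg hq]
        push_cast
        linear_combination ((p : ZMod _) ^ (m p : ℕ) * a) * hu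
    have h2 : (((p : ℕ) ^ j : ℕ) : ℚ) * y = (((p : ℕ) : ℤ) ^ (m p : ℕ) * a : ℤ) := by
      simp only [y]
      push_cast
      rw [mul_div_cancel₀ _ hpj]
    refine ⟨⟨(x, y), _, pow_ne_zero j p.2.ne_zero, _, h1, h2⟩, DFinsupp.ext fun q => ?_⟩
    rw [toPruferSum_apply]
    by_cases hq : q = p
    · subst hq
      rw [DirectSum.of_eq_same, pruferComponent_eq q _ (a := 0) (by simp [x])]
      congr 1
      have hp0 : ((q : ℕ) : ℚ_[(q : ℕ)]) ≠ 0 := by exact_mod_cast q.2.ne_zero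
      simp only [y]
      push_cast
      field_simp
      simp
    · rw [pruferComponent_eq_zero_of_not_dvd h1 h2 fun h =>
        hq (Subtype.ext ((Nat.prime_dvd_prime_iff_eq q.2 p.2).1 (q.2.dvd_of_dvd_pow h)))]
      exact (DirectSum.of_eq_of_ne _ _ _ hq).symm

end Torsion

/-! ### Divisible torsion-free groups -/

section Divisible

variable {V : Type} [AddCommGroup V]

/-- A group on which nonzero integers act bijectively is isomorphic to a rational vector space. -/
theorem exists_ratModule_addEquiv (hV : ∀ n : ℤ, n ≠ 0 → Function.Bijective fun v : V => n • v) :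
    ∃ (W : Type) (_ : AddCommGroup W) (_ : Module ℚ W), Nonempty (V ≃+ W) := by
  -- Since nonzero integers act bijectively, `V` is its own localization and inherits the structure
  -- of a `ℚ`-module.
  have : IsLocalizedModule (nonZeroDivisors ℤ) (LinearMap.id : V →ₗ[ℤ] V) :=
    { map_units := fun n => (Module.End.isUnit_iff _).2 (hV n (nonZeroDivisors.ne_zero n.2))
      surj := fun v => ⟨(v, 1), one_smul _ v⟩
      exists_of_eq := fun h => ⟨1, congrArg _ h⟩ }
  let e := IsLocalizedModule.iso (nonZeroDivisors ℤ) (LinearMap.id : V →ₗ[ℤ] V)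
  exact ⟨LocalizedModule (nonZeroDivisors ℤ) V, inferInstance,
    LocalizedModule.moduleOfIsLocalization (S := nonZeroDivisors ℤ) (M := V) (T := ℚ),
    ⟨(AddEquiv.mk' e.toEquiv e.map_add').symm⟩⟩

/-- Rational vector spaces of the cardinality of the continuum are determined up to isomorphism. -/
theorem nonempty_addEquiv_finsupp {W : Type} [AddCommGroup W] [Module ℚ W]
    (hW : Cardinal.mk W = Cardinal.continuum) {ι : Type} (hι : Cardinal.mk ι = Cardinal.continuum) :
    Nonempty (W ≃+ (ι →₀ ℚ)) := by
  let b := Module.Free.chooseBasis ℚ W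
  have hne : Nonempty (Module.Free.ChooseBasisIndex ℚ W) := by
    by_contra hempty
    rw [not_nonempty_iff] at hempty
    have h1 : Subsingleton W := b.repr.toEquiv.subsingleton
    have h2 := Cardinal.le_one_iff_subsingleton.2 h1
    rw [hW] at h2
    exact absurd (Cardinal.nat_lt_continuum 1) (not_lt.2 h2)
  have hcard : Cardinal.mk (Module.Free.ChooseBasisIndex ℚ W) = Cardinal.continuum := by
    have h1 := Cardinal.mk_congr b.repr.toEquiv
    rw [hW, Cardinal.mk_finsupp_of_infinite', Cardinal.mkRat] at h1
    rcases max_choice (Cardinal.mk (Module.Free.ChooseBasisIndex ℚ W)) Cardinal.aleph0 with h | h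
    · rw [← h, h1]
    · rw [h] at h1
      exact absurd h1 Cardinal.aleph0_lt_continuum.ne'
  obtain ⟨e⟩ := Cardinal.eq.1 (hcard.trans hι.symm)
  exact ⟨b.repr.toAddEquiv.trans (Finsupp.domCongr e)⟩

theorem nonempty_addEquiv_pi_finsupp (hV : ∀ n : ℤ, n ≠ 0 → Function.Bijective fun v : V => n • v)
    (hc : Cardinal.mk V = Cardinal.continuum) {d : ℕ} (hd : 1 ≤ d) {ι : Type}
    (hι : Cardinal.mk ι = Cardinal.continuum) : Nonempty ((Fin d → V) ≃+ (ι →₀ ℚ)) := by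
  obtain ⟨W, _, _, ⟨e⟩⟩ := exists_ratModule_addEquiv hV
  have hW : Cardinal.mk W = Cardinal.continuum := (Cardinal.mk_congr e.toEquiv).symm.trans hc
  have hWd : Cardinal.mk (Fin d → W) = Cardinal.continuum := by
    rw [← Cardinal.power_def, hW, Cardinal.mk_fin]
    exact Cardinal.power_nat_eq Cardinal.aleph0_le_continuum hd
  obtain ⟨f⟩ := nonempty_addEquiv_finsupp hWd hι
  exact ⟨(AddEquiv.piCongrRight fun _ => e).trans f⟩

end Divisible

/-! ### The group `∏ₚ ℤ/p^{m_p} / ℤ` -/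

section Structure

variable (m : Nat.Primes → ℕ+)

/-- The residue families some nonzero multiple of which is an integer. -/
def torsionPart : AddSubgroup (ScalarResidues m) :=
  (commensurable m).map (AddMonoidHom.fst (ScalarResidues m) ℚ)

variable {m}

theorem mem_torsionPart {x : ScalarResidues m} : x ∈ torsionPart m ↔
    ∃ n : ℕ, n ≠ 0 ∧ ∃ k : ℤ, (n : ScalarResidues m) * x = k := by
  constructor
  · rintro ⟨r, ⟨n, hn, k, h1, -⟩, rfl⟩
    exact ⟨n, hn, k, h1⟩
  · rintro ⟨n, hn, k, h⟩
    have hn' : (n : ℚ) ≠ 0 := by exact_mod_cast hn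
    exact ⟨(x, k / n), ⟨n, hn, k, h, mul_div_cancel₀ _ hn'⟩, rfl⟩

/-- A commensurable pair is determined by its Prüfer image together with its rational coordinate,
and both range over countable sets. -/
theorem countable_torsionPart : Countable (torsionPart m) := by
  have hinj : Function.Injective fun r : commensurable m => (toPruferSum r, r.1.2) := by
    intro r s h
    have h1 : toPruferSum (r - s) = 0 := by rw [map_sub, sub_eq_zero]; exact (Prod.ext_iff.1 h).1
    obtain ⟨k, hk1, hk2⟩ := (toPruferSum_eq_zero_iff _).1 h1
    have h2 : r.1.2 = s.1.2 := (Prod.ext_iff.1 h).2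
    have h3 : (r - s).1.2 = r.1.2 - s.1.2 := rfl
    rw [h3, h2, sub_self, eq_comm, Int.cast_eq_zero] at hk2
    rw [hk2, Int.cast_zero] at hk1
    have h4 : r.1.1 - s.1.1 = 0 := hk1
    exact Subtype.ext (Prod.ext (sub_eq_zero.1 h4) h2)
  have : Countable PruferSum := inferInstanceAs (Countable (Π₀ p, Prufer p))
  have : Countable (commensurable m) := hinj.countable
  have hs : Function.Surjective fun r : commensurable m =>
      (⟨r.1.1, ⟨r.1, r.2, rfl⟩⟩ : torsionPart m) := by
    rintro ⟨_, ⟨r, hr, rfl⟩⟩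
    exact ⟨⟨r, hr⟩, rfl⟩
  exact hs.countable

theorem exists_mul_add_torsion {n : ℕ} (hn : n ≠ 0) (x : ScalarResidues m) :
    ∃ w, x - n * w ∈ torsionPart m := by
  classical
  -- Division by `n` is possible wherever `n` is a unit. The remainder lives at the finitely many
  -- primes dividing `n` and is killed by the product of the `p^{m_p}` with `p ≤ n`.
  refine ⟨fun p => if (p : ℕ) ∣ n then 0 else (n : ZMod _)⁻¹ * x p, mem_torsionPart.2
    ⟨∏ p ∈ primesLT (n + 1), (p : ℕ) ^ (m p : ℕ),
      Finset.prod_ne_zero_iff.2 fun p _ => pow_ne_zero _ p.2.ne_zero, 0, ?_⟩⟩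
  funext p
  show ((∏ p ∈ primesLT (n + 1), (p : ℕ) ^ (m p : ℕ) : ℕ) : ZMod ((p : ℕ) ^ (m p : ℕ))) *
    (x p - (n : ZMod _) * (if (p : ℕ) ∣ n then 0 else (n : ZMod _)⁻¹ * x p)) =
      ((0 : ℤ) : ZMod _)
  rw [Int.cast_zero]
  by_cases hp : (p : ℕ) ∣ n
  · have hmem : p ∈ primesLT (n + 1) :=
      mem_primesLT.2 (Nat.lt_succ_of_le (Nat.le_of_dvd (Nat.pos_of_ne_zero hn) hp))
    rw [(ZMod.natCast_eq_zero_iff _ _).2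
      (Finset.dvd_prod_of_mem (fun p : Nat.Primes => (p : ℕ) ^ (m p : ℕ)) hmem), zero_mul]
  · have hu : IsUnit (n : ZMod ((p : ℕ) ^ (m p : ℕ))) :=
      (ZMod.isUnit_iff_coprime _ _).2
        ((((Nat.Prime.coprime_iff_not_dvd p.2).2 hp).symm).pow_right _)
    rw [if_neg hp, ← mul_assoc, ZMod.mul_inv_of_unit _ hu, one_mul, sub_self, mul_zero]

theorem bijective_zsmul_quotient_torsionPart {n : ℤ} (hn : n ≠ 0) :
    Function.Bijective fun v : ScalarResidues m ⧸ torsionPart m => n • v := by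
  constructor
  · refine (injective_iff_map_eq_zero
      (zsmulAddGroupHom n : (ScalarResidues m ⧸ torsionPart m) →+ _)).2 fun v hv => ?_
    induction v using QuotientAddGroup.induction_on with
    | H x =>
      have h1 : (QuotientAddGroup.mk (n • x) : ScalarResidues m ⧸ torsionPart m) = 0 := hv
      rw [QuotientAddGroup.eq_zero_iff] at h1 ⊢
      obtain ⟨a, ha, k, hk⟩ := mem_torsionPart.1 h1
      refine mem_torsionPart.2 ⟨a * n.natAbs, mul_ne_zero ha (Int.natAbs_ne_zero.2 hn),
        n.sign * k, ?_⟩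
      rw [zsmul_eq_mul] at hk
      have h2 : (n.natAbs : ScalarResidues m) = (n.sign : ScalarResidues m) * n := by
        rw [← Int.cast_mul, Int.sign_mul_self_eq_natAbs, Int.cast_natCast]
      push_cast
      rw [h2, ← hk]
      ring
  · intro v
    induction v using QuotientAddGroup.induction_on with
    | H x =>
      obtain ⟨w, hw⟩ := exists_mul_add_torsion (Int.natAbs_ne_zero.2 hn) x
      refine ⟨QuotientAddGroup.mk (n.sign * w), ?_⟩
      show (QuotientAddGroup.mk (n • (n.sign * w)) : ScalarResidues m ⧸ torsionPart m) = _
      rw [QuotientAddGroup.eq, zsmul_eq_mul, ← mul_assoc, ← Int.cast_mul,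
        mul_comm n, Int.sign_mul_self_eq_natAbs, Int.cast_natCast, neg_add_eq_sub]
      exact hw

theorem mk_scalarResidues : Cardinal.mk (ScalarResidues m) = Cardinal.continuum := by
  have hprimes : Cardinal.mk Nat.Primes = Cardinal.aleph0 := Cardinal.mk_eq_aleph0 _
  apply le_antisymm
  · have hinj : Function.Injective fun (x : ScalarResidues m) (p : Nat.Primes) => (x p).val :=
      fun x y h => funext fun p => ZMod.val_injective _ (congrFun h p)
    refine (Cardinal.mk_le_of_injective hinj).trans ?_
    rw [← Cardinal.power_def, hprimes, Cardinal.mk_nat, Cardinal.aleph0_power_aleph0]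
  · have hinj : Function.Injective fun (b : Nat.Primes → Bool) (p : Nat.Primes) =>
        (if b p then 1 else 0 : ZMod ((p : ℕ) ^ (m p : ℕ))) := by
      intro b c h
      funext p
      have : Fact (1 < (p : ℕ) ^ (m p : ℕ)) := ⟨Nat.one_lt_pow (m p).pos.ne' p.2.one_lt⟩
      have hp := congrFun h p
      cases hb : b p <;> cases hc : c p <;> simp_all
    refine le_trans ?_ (Cardinal.mk_le_of_injective hinj)
    rw [← Cardinal.power_def, hprimes, Cardinal.mk_bool, Cardinal.two_power_aleph0]

/-- A group of size continuum modulo a countable subgroup still has size continuum. -/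
theorem mk_quotient_torsionPart :
    Cardinal.mk (ScalarResidues m ⧸ torsionPart m) = Cardinal.continuum := by
  have h1 := Cardinal.mk_congr (AddSubgroup.addGroupEquivQuotientProdAddSubgroup (s := torsionPart m))
  rw [mk_scalarResidues, Cardinal.mk_prod, Cardinal.lift_id, Cardinal.lift_id] at h1
  have hT : Cardinal.mk (torsionPart m) ≤ Cardinal.aleph0 :=
    Cardinal.mk_le_aleph0_iff.2 countable_torsionPart
  apply le_antisymm
  · exact (Cardinal.mk_le_of_surjective QuotientAddGroup.mk_surjective).trans
      mk_scalarResidues.le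
  · by_contra hlt
    rw [not_le] at hlt
    exact absurd h1 (Cardinal.mul_lt_of_lt Cardinal.aleph0_le_continuum hlt
      (hT.trans_lt Cardinal.aleph0_lt_continuum)).ne'

variable (m)

/-- Modulo the integers, `∏ₚ ℤ/p^{m_p}` splits into a torsion-free divisible group and the sum of
the Prüfer groups. -/
theorem exists_splitting :
    ∃ Ψ : ScalarResidues m →+ (ScalarResidues m ⧸ torsionPart m) × PruferSum,
      Function.Surjective Ψ ∧ ∀ x, Ψ x = 0 ↔ ∃ k : ℤ, x = k := by
  -- Injectivity extends the Prüfer map from the commensurable pairs, embedded by their first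
  -- coordinate, to the entire ring of residues.
  obtain ⟨Φ, hΦ⟩ := (Module.Baer.of_divisible PruferSum).extension_property_addMonoidHom
    ((AddMonoidHom.fst (ScalarResidues m) ℚ).comp (commensurable m).subtype)
    ((injective_iff_map_eq_zero _).2 fun r hr =>
      Subtype.ext (Prod.ext hr (commensurable_snd_eq_zero r.2 hr))) toPruferSum
  have hΦ' : ∀ r : commensurable m, Φ r.1.1 = toPruferSum r := fun r =>
    DFunLike.congr_fun hΦ r
  refine ⟨(QuotientAddGroup.mk' (torsionPart m)).prod Φ, ?_, fun x => ⟨fun h => ?_, ?_⟩⟩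
  · rintro ⟨v, u⟩
    induction v using QuotientAddGroup.induction_on with
    | H x =>
      -- Adding a commensurable family leaves the class modulo `torsionPart m` unchanged and adjusts
      -- the Prüfer coordinate at will.
      obtain ⟨r, hr⟩ := surjective_toPruferSum (m := m) (u - Φ x)
      refine ⟨x + r.1.1, Prod.ext ?_ ?_⟩
      · show (QuotientAddGroup.mk (x + r.1.1) : ScalarResidues m ⧸ torsionPart m) = _
        rw [eq_comm, QuotientAddGroup.eq, neg_add_cancel_left]
        exact ⟨r.1, r.2, rfl⟩
      · show Φ (x + r.1.1) = u
        rw [map_add, hΦ', hr, add_sub_cancel]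
  · obtain ⟨r, hr, rfl⟩ := (QuotientAddGroup.eq_zero_iff x).1 (Prod.ext_iff.1 h).1
    have h1 : toPruferSum ⟨r, hr⟩ = 0 := (hΦ' ⟨r, hr⟩).symm.trans (Prod.ext_iff.1 h).2
    obtain ⟨k, hk, -⟩ := (toPruferSum_eq_zero_iff _).1 h1
    exact ⟨k, hk⟩
  · rintro ⟨k, rfl⟩
    have hr : ((k : ScalarResidues m), (k : ℚ)) ∈ commensurable m :=
      ⟨1, one_ne_zero, k, by simp, by simp⟩
    refine Prod.ext ((QuotientAddGroup.eq_zero_iff _).2 ⟨_, hr, rfl⟩) ?_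
    exact (hΦ' ⟨_, hr⟩).trans ((toPruferSum_eq_zero_iff _).2 ⟨k, rfl, rfl⟩)

/-- The splitting is applied in each of the `d` coordinates. The exponents leave no trace on the
right-hand side, which is why all these groups are abstractly isomorphic. -/
theorem nonempty_modelCover_addEquiv {d : ℕ} (hd : 1 ≤ d) {ι : Type}
    (hι : Cardinal.mk ι = Cardinal.continuum) :
    Nonempty ((modelCover d m).Quot ≃+ (ι →₀ ℚ) × (Fin d → PruferSum)) := by
  obtain ⟨Ψ, hsurj, hker⟩ := exists_splitting m
  obtain ⟨e⟩ := nonempty_addEquiv_pi_finsupp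
    (fun n hn => bijective_zsmul_quotient_torsionPart (m := m) hn) mk_quotient_torsionPart hd hι
  let Ψd : Residues d m →+ (Fin d → ScalarResidues m ⧸ torsionPart m) × (Fin d → PruferSum) :=
    AddMonoidHom.mk' (fun x => (fun i => (Ψ fun p => x p i).1, fun i => (Ψ fun p => x p i).2))
      fun x y => by
        have h : ∀ i, Ψ (fun p => (x + y) p i) = Ψ (fun p => x p i) + Ψ fun p => y p i :=
          fun i => map_add Ψ _ _
        refine Prod.ext (funext fun i => ?_) (funext fun i => ?_)
        · exact congrArg Prod.fst (h i)
        · exact congrArg Prod.snd (h i)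
  have hs : Function.Surjective Ψd := by
    rintro ⟨v, u⟩
    choose x hx using fun i => hsurj (v i, u i)
    refine ⟨fun p i => x i p, Prod.ext (funext fun i => ?_) (funext fun i => ?_)⟩
    · exact congrArg Prod.fst (hx i)
    · exact congrArg Prod.snd (hx i)
  have hk : Ψd.ker = (diag d m).range := by
    ext x
    rw [AddMonoidHom.mem_ker, AddMonoidHom.mem_range]
    constructor
    · intro h
      have h1 : ∀ i, ∃ k : ℤ, (fun p => x p i : ScalarResidues m) = k := fun i =>
        (hker _).1 (Prod.ext (congrFun (Prod.ext_iff.1 h).1 i) (congrFun (Prod.ext_iff.1 h).2 i))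
      choose k hk using h1
      refine ⟨k, funext fun p => funext fun i => (congrFun (hk i) p).symm⟩
    · rintro ⟨k, rfl⟩
      have h1 : ∀ i, Ψ (fun p => diag d m k p i) = 0 := fun i => (hker _).2 ⟨k i, rfl⟩
      exact Prod.ext (funext fun i => congrArg Prod.fst (h1 i))
        (funext fun i => congrArg Prod.snd (h1 i))
  exact ⟨((QuotientAddGroup.quotientAddEquivOfEq hk).symm.trans
    (QuotientAddGroup.quotientKerEquivOfSurjective Ψd hs)).trans
      (AddEquiv.prodCongr e (AddEquiv.refl _))⟩

variable {m} in
theorem Cofiltration.nonempty_completionCover_addEquiv {d : ℕ} (hd : 1 ≤ d)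
    (A : Cofiltration (invPrimesPow d m)) {ι : Type}
    (hι : Cardinal.mk ι = Cardinal.continuum) :
    Nonempty (A.completionCover.Quot ≃+ (ι →₀ ℚ) × (Fin d → PruferSum)) := by
  obtain ⟨e⟩ := nonempty_modelCover_addEquiv m hd hι
  obtain ⟨f⟩ := A.bidefinablyIsomorphic_modelCover.definablyIsomorphic.abstractlyIsomorphic
  exact ⟨f.symm.trans e⟩

theorem Cofiltration.abstractlyIsomorphic_completionCover {d : ℕ} (hd : 1 ≤ d)
    {m m' : Nat.Primes → ℕ+} (A : Cofiltration (invPrimesPow d m))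
    (A' : Cofiltration (invPrimesPow d m')) :
    AbstractlyIsomorphic A.completionCover A'.completionCover := by
  obtain ⟨e⟩ := A.nonempty_completionCover_addEquiv hd Cardinal.mk_real
  obtain ⟨e'⟩ := A'.nonempty_completionCover_addEquiv hd Cardinal.mk_real
  exact ⟨e.trans e'.symm⟩

theorem abstractlyIsomorphic_extCover {d : ℕ} (hd : 1 ≤ d) (m m' : Nat.Primes → ℕ+) :
    AbstractlyIsomorphic (extCover (invPrimesPow d m) ℤ) (extCover (invPrimesPow d m') ℤ) := by
  obtain ⟨e⟩ := nonempty_modelCover_addEquiv m hd Cardinal.mk_real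
  obtain ⟨e'⟩ := nonempty_modelCover_addEquiv m' hd Cardinal.mk_real
  obtain ⟨f⟩ := (bidefinablyIsomorphic_extCover_modelCover
    d m).definablyIsomorphic.abstractlyIsomorphic
  obtain ⟨f'⟩ := (bidefinablyIsomorphic_extCover_modelCover
    d m').definablyIsomorphic.abstractlyIsomorphic
  exact ⟨((f.trans e).trans e'.symm).trans f'.symm⟩

end Structure

end DefinableExt

theorem mainTheorem11 (d : ℕ) (hd : 1 ≤ d) :
    -- the groups `Ext(ℤ[1/𝒫ᵐ]ᵈ, ℤ)`
    (∀ m m' : Nat.Primes → ℕ+,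
      AbstractlyIsomorphic (extCover (invPrimesPow d m) ℤ) (extCover (invPrimesPow d m') ℤ) ∧
      (DefinablyIsomorphic (extCover (invPrimesPow d m) ℤ) (extCover (invPrimesPow d m') ℤ) ↔
        EqStar m m')) ∧
    (∃ S ⊆ Set.range fun m : Nat.Primes → ℕ+ => extCover (invPrimesPow d m) ℤ,
      Cardinal.mk S = Cardinal.continuum ∧
      S.Pairwise fun X Y => AbstractlyIsomorphic X Y ∧ ¬ DefinablyIsomorphic X Y) ∧
    -- the groups `ℤ̂ᵈ_Λ / ℤᵈ` for `Λ = ℤ[1/𝒫ᵐ]ᵈ`, computed with arbitrary cofiltrations of `Λ`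
    (∀ (m m' : Nat.Primes → ℕ+) (A : Cofiltration (invPrimesPow d m))
      (A' : Cofiltration (invPrimesPow d m')),
      AbstractlyIsomorphic A.completionCover A'.completionCover ∧
      (DefinablyIsomorphic A.completionCover A'.completionCover ↔ EqStar m m')) ∧
    (∀ A : ∀ m : Nat.Primes → ℕ+, Cofiltration (invPrimesPow d m),
      ∃ S ⊆ Set.range fun m => (A m).completionCover,
        Cardinal.mk S = Cardinal.continuum ∧
        S.Pairwise fun X Y => AbstractlyIsomorphic X Y ∧ ¬ DefinablyIsomorphic X Y) ∧
    (∀ (m : Nat.Primes → ℕ+) (A : Cofiltration (invPrimesPow d m)) (ι : Type),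
      Cardinal.mk ι = Cardinal.continuum →
      Nonempty (A.completionCover.Quot ≃+
        (ι →₀ ℚ) × (Fin d → DirectSum Nat.Primes fun p => Prufer p))) := by
  refine ⟨fun m m' => ⟨abstractlyIsomorphic_extCover hd m m', definablyIsomorphic_extCover_iff hd m m'⟩,
    exists_continuum_pairwise_not_definablyIsomorphic _ (abstractlyIsomorphic_extCover hd)
      (definablyIsomorphic_extCover_iff hd),
    fun m m' A A' => ⟨A.abstractlyIsomorphic_completionCover hd A',
      A.definablyIsomorphic_completionCover_iff hd A'⟩,
    fun A => exists_continuum_pairwise_not_definablyIsomorphic _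
      (fun m m' => (A m).abstractlyIsomorphic_completionCover hd (A m'))
      fun m m' => (A m).definablyIsomorphic_completionCover_iff hd (A m'),
    fun m A ι hι => A.nonempty_completionCover_addEquiv hd hι⟩
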